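/- **Setting.** Let $G=(V,E)$ be a finite weighted undirected graph, $n=|V|$, with weights $w\ge 0$, all weighted degrees equal to $1$, and lazy: $w(x,x)\ge\frac12$ for every vertex $x$. Write $w(S,T)=\sum_{x\in S,\,y\in T}w(x,y)$. For $\emptyset\ne S\subseteq V$ let $$\phi(S)=\frac{w(S,V\setminus S)}{|S|},\qquad N_{1/2}(S)=\min\{|T| : T\subseteq V\setminus S,\ w(S,T)\ge \tfrac12 w(S,V\setminus S)\},$$ $$\phi^V(S)=\min\{N_{1/2}(S)/|S|,\,1\},\qquad \Psi(S)=\phi(S)\,\phi^V(S).$$ Let $\Delta$ be the largest number of neighbours of a vertex (a self-loop makes a vertex a neighbour of itself). **Algorithm.** The evolving set process moves from $S$ to $\tilde S=\{y: w(\{y\},S)\ge U\}$ with $U$ uniform in $[0,1]$; its volume-biased version moves from $S\neq\emptyset$ to $S'$ with probability $\frac{|S'|}{|S|}\Pr[\tilde S=S']$. Given a start vertex $v$, parameters $k\ge1$, $\varphi>0$, $\epsilon>0$ and numerical constants $c,C>0$, the evolving set algorithm runs, one after the other, up to $\lceil Ck^{\epsilon}\rceil$ independent copies of the volume-biased process from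 $\{v\}$, each for at most $\lceil c(1+\epsilon\log k)/\varphi\rceil$ steps. It returns the first set $S$ it meets with $|S|\le Ck^{1+\epsilon}$ and $\Psi(S)\le C\varphi/\epsilon$; a copy is abandoned when its set would get larger than $Ck^{1+\epsilon}$. **Running time.** The values $w(\{y\},S)>0$ of the current set $S$ are kept in balanced search trees, and one tree operation costs $\lfloor\log_2 n\rfloor+1$. When a copy starts, and whenever its set changes, one operation is charged for each neighbour of each vertex that enters or leaves the set, and one more for drawing the change together with the number of idle steps before it and for evaluating the new set. A step in which the copy is abandoned costs one operation. **Statement.** For every $\epsilon_0>0$ there are constants $c,C,D,p>0$ such that the following holds for all such $G$, every target set $S^*\subseteq V$ with $S^*\neq\emptyset$ and $\phi(S^*)>0$, and every $0<\epsilon\le\epsilon_0$. There is a subset $S'\subseteq S^*$ with $|S'|\ge|S^*|/2$ such that for every $v\in S'$, with probability at least $p$, the evolving set algorithm with start vertex $v$, $k=|S^*|$ and $\varphi=\phi(S^*)$ returns a non-empty set $S$ with $$\Psi(S)\le C\,\frac{\phi(S^*)}{\epsilon},\qquad |S|\le C\,|S^*|^{1+\epsilon},$$ and its running time is at most $D\,\Delta\,|S^*|^{1+2\epsilon}\,\phi(S^*)^{-1/2}\log^2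 n$. -/

import Mathlib

open scoped ENNReal
open MeasureTheory

noncomputable section

/-- A weighted undirected graph on `V` (self-loops allowed), regular, with the weights scaled so
that every weighted degree is `1`.  `w i j` is the weight of the edge `ij` (`0` for a non-edge); it
is also the transition matrix of the random walk. -/
structure RegularGraph (V : Type*) [Fintype V] where
  w : V → V → ℝ
  nonneg : ∀ i j, 0 ≤ w i j
  symm : ∀ i j, w i j = w j i
  degree_eq_one : ∀ i, ∑ j, w i j = 1

namespace RegularGraph

variable {V : Type*} [Fintype V] (G : RegularGraph V)

/-- The graph is lazy: every vertex carries a self-loop of weight at least `1/2`. -/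
def IsLazy : Prop := ∀ i, 1 / 2 ≤ G.w i i

/-- `w(S, T)`: the total weight between `S` and `T`
(used only for disjoint `S`, `T`, or with `S` a single vertex). -/
def weight (S T : Finset V) : ℝ := ∑ i ∈ S, ∑ j ∈ T, G.w i j

lemma weight_singleton_nonneg (y : V) (S : Finset V) : 0 ≤ G.weight {y} S := by
  simpa [weight] using Finset.sum_nonneg fun j _ => G.nonneg y j

lemma weight_singleton_le_one (y : V) (S : Finset V) : G.weight {y} S ≤ 1 := by
  rw [← G.degree_eq_one y]
  simpa [weight] using
    Finset.sum_le_univ_sum_of_nonneg (s := S) (fun j => G.nonneg y j)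

lemma sum_weight_singleton (S : Finset V) : ∑ y, G.weight {y} S = S.card := by
  simp only [weight, Finset.sum_singleton]
  rw [Finset.sum_comm]
  have : ∀ j ∈ S, ∑ i, G.w i j = 1 := fun j _ => by
    rw [← G.degree_eq_one j]
    exact Finset.sum_congr rfl fun i _ => G.symm i j
  rw [Finset.sum_congr rfl this]
  simp

variable [DecidableEq V]

/-- The expansion `φ(S) = w(S, V - S) / |S|`. -/
def expansion (S : Finset V) : ℝ := G.weight S Sᶜ / (S.card : ℝ)

/-- `N_{1/2}(S)`: the least size of a set `T ⊆ V - S` that receives at least half of the weight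
leaving `S`.  (The set of candidates contains `|V - S|`, so the infimum is a minimum.) -/
def halfBoundary (S : Finset V) : ℕ :=
  sInf {m : ℕ | ∃ T : Finset V, T ⊆ Sᶜ ∧ T.card = m ∧ G.weight S Sᶜ / 2 ≤ G.weight S T}

/-- The robust vertex expansion `φ^V(S) = min {N_{1/2}(S) / |S|, 1}`. -/
def vertexExpansion (S : Finset V) : ℝ := min ((G.halfBoundary S : ℝ) / (S.card : ℝ)) 1

/-- `Ψ(S) = φ(S) φ^V(S)`. -/
def Psi (S : Finset V) : ℝ := G.expansion S * G.vertexExpansion S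

/-! ### The evolving set process -/

/-- The set that follows `S` for the threshold `u`: all `y` with `w(y, S) ≥ u`. -/
def nextSet (S : Finset V) (u : ℝ) : Finset V :=
  Finset.univ.filter fun y => u ≤ G.weight {y} S

/-- Transition probability of the evolving set process:
the probability that `nextSet S U = S'` for `U` uniform in `[0, 1]`. -/
def espKernel (S S' : Finset V) : ℝ≥0∞ :=
  volume {u : ℝ | u ∈ Set.Icc 0 1 ∧ G.nextSet S u = S'}

lemma measurableSet_nextSet_eq (S S' : Finset V) :
    MeasurableSet {u : ℝ | u ∈ Set.Icc (0 : ℝ) 1 ∧ G.nextSet S u = S'} := by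
  refine MeasurableSet.inter measurableSet_Icc ?_
  have h : {u : ℝ | G.nextSet S u = S'} = ⋂ y : V, {u : ℝ | u ≤ G.weight {y} S ↔ y ∈ S'} := by
    ext u
    simp [nextSet, Finset.ext_iff]
  change MeasurableSet {u : ℝ | G.nextSet S u = S'}
  rw [h]
  refine MeasurableSet.iInter fun y => ?_
  by_cases hy : y ∈ S'
  · simp only [hy, iff_true]
    exact measurableSet_Iic
  · simp only [hy, iff_false, not_le]
    exact measurableSet_Ioi

/-- The expected size of the next set is the size of the present one. -/
lemma sum_card_mul_espKernel (S : Finset V) :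
    ∑ S' : Finset V, (S'.card : ℝ≥0∞) * G.espKernel S S' = S.card := by
  have h1 : ∀ y : V, ∑ S' : Finset V with y ∈ S', G.espKernel S S' =
      ENNReal.ofReal (G.weight {y} S) := by
    intro y
    unfold espKernel
    rw [← measure_biUnion_finset]
    · have : (⋃ S' ∈ Finset.univ.filter (fun S' : Finset V => y ∈ S'),
          {u : ℝ | u ∈ Set.Icc (0 : ℝ) 1 ∧ G.nextSet S u = S'}) =
          Set.Icc 0 (G.weight {y} S) := by
        ext u
        have := G.weight_singleton_le_one y S
        simp only [Finset.mem_filter, Finset.mem_univ, true_and, Set.mem_iUnion, Set.mem_ofPred_eq,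
          exists_prop, Set.mem_Icc]
        constructor
        · rintro ⟨S', hy, ⟨h0, _⟩, rfl⟩
          exact ⟨h0, by simpa [nextSet] using hy⟩
        · rintro ⟨h0, hu⟩
          exact ⟨_, by simpa [nextSet] using hu, ⟨h0, hu.trans this⟩, rfl⟩
      rw [this, Real.volume_Icc, sub_zero]
    · intro A _ B _ hAB
      refine Set.disjoint_left.2 fun u hu hu' => hAB ?_
      exact hu.2.symm.trans hu'.2
    · intro S' _
      exact G.measurableSet_nextSet_eq S S'
  calc ∑ S' : Finset V, (S'.card : ℝ≥0∞) * G.espKernel S S'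
      = ∑ S' : Finset V, ∑ y : V, if y ∈ S' then G.espKernel S S' else 0 := by
        refine Finset.sum_congr rfl fun S' _ => ?_
        rw [← Finset.sum_filter]
        simp
    _ = ∑ y : V, ENNReal.ofReal (G.weight {y} S) := by
        rw [Finset.sum_comm]
        refine Finset.sum_congr rfl fun y _ => ?_
        rw [← Finset.sum_filter, h1]
    _ = S.card := by
        rw [← ENNReal.ofReal_sum_of_nonneg fun y _ => G.weight_singleton_nonneg y S,
          sum_weight_singleton, ENNReal.ofReal_natCast]

/-- One step of the volume-biased evolving set process from `S ≠ ∅`: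
the next set is `S'` with probability `(|S'| / |S|) · P(S → S')`. -/
def biasedStep (S : Finset V) : PMF (Finset V) :=
  if h : S.Nonempty then
    PMF.ofFintype (fun S' => (S'.card : ℝ≥0∞) * G.espKernel S S' / (S.card : ℝ≥0∞)) <| by
      simp only [div_eq_mul_inv]
      rw [← Finset.sum_mul, sum_card_mul_espKernel]
      exact ENNReal.mul_inv_cancel (by simpa using h.ne_empty) (by simp)
  else PMF.pure ∅

/-! ### The evolving set algorithm and its running time

A copy of the process keeps `w(y, S)`, for the vertices `y` where it is positive, in balanced search
trees (one for `y ∈ S`, one for `y ∉ S`) ordered by `w(y, S)` and augmented with subtree sizes and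
sums.  The following cost `O(log n)` each, and every one of them is charged `opCost`:
* inserting, deleting or changing the entry of one vertex; so a vertex `x` that enters or leaves the
  current set is charged once for each neighbour, as `w(y, S)` changes for all neighbours `y` of `x`;
* drawing the next set that differs from the current one, together with the (geometrically
  distributed) number of steps until then, finding its size, and computing `φ` and `φ^V` of the
  current set.
-/

/-- The number of neighbours of `x` (`x` itself included if it has a self-loop). -/
def deg (x : V) : ℕ := (Finset.univ.filter fun y => 0 < G.w x y).card

/-- The largest number of neighbours of a vertex. -/
def maxDeg : ℕ := Finset.univ.sup G.deg

/-- Cost of one search tree operation, of order `log n`. -/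
def opCost (_ : RegularGraph V) : ℕ := Nat.log 2 (Fintype.card V) + 1

/-- Cost of moving from `S` to `S'`.  Steps that do not change the set are skipped together. -/
def moveCost (S S' : Finset V) : ℕ :=
  if S' = S then 0 else G.opCost * (1 + ∑ x ∈ symmDiff S S', G.deg x)

/-- One copy, from the current set `S`, for at most `T` further steps.  It returns the first
set with `|S| ≤ K` and `Ψ(S) ≤ θ`, and gives up when the size of the set would exceed `K` (which
is noticed before the new set is written down).  The number is the time used. -/
def runCopy (K θ : ℝ) : ℕ → Finset V → PMF (Option (Finset V) × ℕ)
  | 0, S => if (S.card : ℝ) ≤ K ∧ G.Psi S ≤ θ then PMF.pure (some S, 0) else PMF.pure (none, 0)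
  | T + 1, S =>
    if (S.card : ℝ) ≤ K ∧ G.Psi S ≤ θ then PMF.pure (some S, 0)
    else (G.biasedStep S).bind fun S' =>
      if (S'.card : ℝ) ≤ K then
        (runCopy K θ T S').map fun r => (r.1, G.moveCost S S' + r.2)
      else PMF.pure (none, G.opCost)

/-- At most `N` independent copies, each started from `{v}` and run for at most `T` steps,
until one of them returns a set. The second component is the total time. -/
def runCopies (K θ : ℝ) (T : ℕ) (v : V) : ℕ → PMF (Option (Finset V) × ℕ)
  | 0 => PMF.pure (none, 0)
  | N + 1 => (G.runCopy K θ T {v}).bind fun r =>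
      match r with
      | (some S, t) => PMF.pure (some S, G.opCost * (1 + G.deg v) + t)
      | (none, t) =>
        (runCopies K θ T v N).map fun r' => (r'.1, G.opCost * (1 + G.deg v) + t + r'.2)

/-- The evolving set algorithm with start vertex `v`, for the target size `k`, the target expansion
`φ` and the exponent `ε`; `c` and `C` are its numerical constants.  The result is the joint law
of the returned set (`none` if there is none) and of the running time. -/
def evolvingSetAlgorithm (c C : ℝ) (v : V) (k : ℕ) (φ ε : ℝ) : PMF (Option (Finset V) × ℕ) :=
  G.runCopies (C * (k : ℝ) ^ (1 + ε)) (C * φ / ε) ⌈c * (1 + ε * Real.log k) / φ⌉₊ v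
    ⌈C * (k : ℝ) ^ ε⌉₊

end RegularGraph

end

/-! ### One step of the evolving set process. -/

noncomputable section
-- Let `A` be the target set, `k` its size, `φ` its expansion. Three facts about the volume-biased
-- process are combined.
--
-- Growth: `√(|S| / |S'|)` has mean at most `1 - Ψ(S) / 24` in a biased step
-- (`IsLazy.sum_biasedProb_mul_sqrt_le`). While `Ψ > θ` the set therefore tends to grow
-- exponentially, and within `T` steps it would exceed any moderate size bound `K`.
--
-- Confinement: a uniform vertex of the current set moves like the random walk
-- (`sum_biasedProb_mul_average`). If that walk stays in `A`, the set can hardly be much larger than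
-- `A`. The spectrum of the walk killed outside `A` shows that for at least half of the starting
-- vertices it stays in `A` for `T` steps, `T` of order `(1 + ε log k) / φ`, with probability at
-- least a constant times `k ^ (-ε)` (`IsLazy.exists_subset_rpow_le_stayProb`). Together, a copy
-- succeeds with probability of order `k ^ (-ε)` (`IsLazy.runCopy_none_le`), so order `k ^ ε` copies
-- suffice.
--
-- Cost: a step from `S` to `S'` with `|S'| ≤ K` costs of order `K |S ∆ S'| / |S'|` tree updates, up
-- to the degree, with mean of order `K φ(S)`. The mean of `log |S|` gains at least `φ(S)² / 12` per
-- step and never exceeds `log n`, so by an AM-GM bound the sum of the `φ(S)` is of order `√(T log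
-- n)`-type size rather than `T` (`IsLazy.runCopy_cost_le`); this yields the factor `φ ^ (-1/2)`.
-- Markov's inequality turns the mean cost into a bound that holds with constant probability.
lemma Real.mul_min_le_sqrt_sub_one_sq {f : ℝ} (hf : 0 ≤ f) :
    f * min f 1 / 6 ≤ (√(1 + f) - 1) ^ 2 := by
  set s := √(1 + f) with hs
  have hs1 : 1 ≤ s := Real.one_le_sqrt.2 (by linarith)
  -- Since `f = (s - 1)(s + 1)`, the claim reads `(s + 1)² ≤ 6` when `f ≤ 1`, where `s ≤ √2 < 1.43`,
  -- and `s + 1 ≤ 6 (s - 1)`, that is `s ≥ 7 / 5`, when `f ≥ 1`.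
  have hs2 : s ^ 2 = 1 + f := Real.sq_sqrt (by linarith)
  have hf' : f = (s - 1) * (s + 1) := by nlinarith
  rcases le_total f 1 with h | h
  · rw [min_eq_left h]
    have : s ≤ 3 / 2 - 0.07 := by
      apply Real.sqrt_le_iff.2
      constructor <;> norm_num
      linarith
    rw [hf']
    have h6 : (s + 1) ^ 2 ≤ 6 := by nlinarith
    nlinarith [mul_nonneg (sq_nonneg (s - 1)) (sub_nonneg.2 h6)]
  · rw [min_eq_right h, mul_one]
    have : 7 / 5 ≤ s := by
      apply Real.le_sqrt_of_sq_le
      norm_num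
      linarith
    rw [hf']
    nlinarith

namespace RegularGraph

variable {V : Type*} [Fintype V] [DecidableEq V] (G : RegularGraph V)

/-- The transition probability of the evolving set process as a real number. -/
def stepProb (S S' : Finset V) : ℝ := (G.espKernel S S').toReal

lemma espKernel_le_one (S S' : Finset V) : G.espKernel S S' ≤ 1 := by
  calc G.espKernel S S' ≤ volume (Set.Icc (0 : ℝ) 1) := measure_mono fun u hu => hu.1
    _ = 1 := by simp

lemma espKernel_ne_top (S S' : Finset V) : G.espKernel S S' ≠ ∞ :=
  ((G.espKernel_le_one S S').trans_lt ENNReal.one_lt_top).ne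

lemma stepProb_nonneg (S S' : Finset V) : 0 ≤ G.stepProb S S' := ENNReal.toReal_nonneg

lemma ofReal_stepProb (S S' : Finset V) : ENNReal.ofReal (G.stepProb S S') = G.espKernel S S' :=
  ENNReal.ofReal_toReal (G.espKernel_ne_top S S')

lemma exists_eq_nextSet {S S' : Finset V} (h : G.stepProb S S' ≠ 0) :
    ∃ u ∈ Set.Icc (0 : ℝ) 1, G.nextSet S u = S' := by
  by_contra! hne
  apply h
  have : {u : ℝ | u ∈ Set.Icc (0 : ℝ) 1 ∧ G.nextSet S u = S'} = ∅ := by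
    ext u
    simp only [Set.mem_ofPred_eq, Set.mem_empty_iff_false, iff_false, not_and]
    exact hne u
  rw [stepProb, espKernel, this, measure_empty, ENNReal.toReal_zero]

lemma sum_espKernel_filter (S : Finset V) (q : Finset V → Prop) [DecidablePred q] :
    ∑ S' : Finset V with q S', G.espKernel S S' =
      volume {u : ℝ | u ∈ Set.Icc (0 : ℝ) 1 ∧ q (G.nextSet S u)} := by
  unfold espKernel
  rw [← measure_biUnion_finset]
  · congr 1
    ext u
    simp only [Finset.mem_filter, Finset.mem_univ, true_and, Set.mem_iUnion, Set.mem_ofPred_eq,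
      exists_prop]
    constructor
    · rintro ⟨S', hq, hu, rfl⟩
      exact ⟨hu, hq⟩
    · rintro ⟨hu, hq⟩
      exact ⟨_, hq, hu, rfl⟩
  · intro A _ B _ hAB
    exact Set.disjoint_left.2 fun u hu hu' => hAB (hu.2.symm.trans hu'.2)
  · intro S' _
    exact G.measurableSet_nextSet_eq S S'

lemma sum_stepProb_mem (S : Finset V) (y : V) :
    ∑ S' : Finset V with y ∈ S', G.stepProb S S' = G.weight {y} S := by
  unfold stepProb
  rw [← ENNReal.toReal_sum fun S' _ => G.espKernel_ne_top S S', sum_espKernel_filter]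
  have : {u : ℝ | u ∈ Set.Icc (0 : ℝ) 1 ∧ y ∈ G.nextSet S u} = Set.Icc 0 (G.weight {y} S) := by
    ext u
    have := G.weight_singleton_le_one y S
    simp only [nextSet, Finset.mem_filter, Finset.mem_univ, true_and, Set.mem_ofPred_eq,
      Set.mem_Icc]
    constructor
    · rintro ⟨⟨h0, _⟩, h⟩
      exact ⟨h0, h⟩
    · rintro ⟨h0, h⟩
      exact ⟨⟨h0, h.trans this⟩, h⟩
  rw [this, Real.volume_Icc, sub_zero, ENNReal.toReal_ofReal (G.weight_singleton_nonneg y S)]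

lemma sum_stepProb (S : Finset V) : ∑ S' : Finset V, G.stepProb S S' = 1 := by
  have := G.sum_espKernel_filter S (fun _ => True)
  simp only [Finset.filter_true, and_true] at this
  unfold stepProb
  rw [← ENNReal.toReal_sum fun S' _ => G.espKernel_ne_top S S', this]
  change (volume (Set.Icc (0 : ℝ) 1)).toReal = 1
  simp

/-- Duality between the evolving set process and the random walk. -/
lemma sum_stepProb_mul_sum (S : Finset V) (f : V → ℝ) :
    ∑ S' : Finset V, G.stepProb S S' * ∑ y ∈ S', f y = ∑ y, G.weight {y} S * f y := by
  calc ∑ S' : Finset V, G.stepProb S S' * ∑ y ∈ S', f y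
      = ∑ S' : Finset V, ∑ y, if y ∈ S' then G.stepProb S S' * f y else 0 := by
        refine Finset.sum_congr rfl fun S' _ => ?_
        rw [Finset.mul_sum, ← Finset.sum_filter]
        simp
    _ = ∑ y, G.weight {y} S * f y := by
        rw [Finset.sum_comm]
        refine Finset.sum_congr rfl fun y _ => ?_
        rw [← Finset.sum_filter, ← Finset.sum_mul, sum_stepProb_mem]

lemma weight_nonneg (S T : Finset V) : 0 ≤ G.weight S T :=
  Finset.sum_nonneg fun i _ => Finset.sum_nonneg fun j _ => G.nonneg i j

lemma sum_weight_singleton_eq (S T : Finset V) : ∑ y ∈ T, G.weight {y} S = G.weight S T := by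
  simp only [weight, Finset.sum_singleton]
  rw [Finset.sum_comm]
  exact Finset.sum_congr rfl fun i _ => Finset.sum_congr rfl fun j _ => G.symm j i

lemma sum_stepProb_mul_card_inter (S T : Finset V) :
    ∑ S' : Finset V, G.stepProb S S' * ((S' ∩ T).card : ℝ) = G.weight S T := by
  have := G.sum_stepProb_mul_sum S (fun y => if y ∈ T then 1 else 0)
  simp only [← Finset.sum_filter, mul_ite, mul_one, mul_zero] at this
  rw [← sum_weight_singleton_eq]
  rw [show (Finset.univ.filter fun y => y ∈ T) = T by simp] at this
  rw [← this]
  refine Finset.sum_congr rfl fun S' _ => ?_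
  rw [Finset.filter_mem_eq_inter]
  simp

lemma sum_stepProb_mul_card (S : Finset V) :
    ∑ S' : Finset V, G.stepProb S S' * (S'.card : ℝ) = S.card := by
  have := G.sum_stepProb_mul_sum S (fun _ => 1)
  simpa [sum_weight_singleton] using this

lemma weight_self_add_weight_compl (S : Finset V) :
    G.weight S S + G.weight S Sᶜ = S.card := by
  simp only [weight]
  rw [← Finset.sum_add_distrib]
  have : ∀ i ∈ S, ∑ j ∈ S, G.w i j + ∑ j ∈ Sᶜ, G.w i j = 1 := fun i _ => by
    rw [Finset.sum_add_sum_compl, G.degree_eq_one]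
  rw [Finset.sum_congr rfl this]
  simp

lemma sum_stepProb_mul_card_sdiff (S : Finset V) :
    ∑ S' : Finset V, G.stepProb S S' * ((S' \ S).card : ℝ) = G.weight S Sᶜ := by
  rw [← sum_stepProb_mul_card_inter]
  refine Finset.sum_congr rfl fun S' _ => ?_
  rw [Finset.sdiff_eq_inter_compl]

lemma sum_stepProb_mul_card_sdiff' (S : Finset V) :
    ∑ S' : Finset V, G.stepProb S S' * ((S \ S').card : ℝ) = G.weight S Sᶜ := by
  have h : ∀ S' : Finset V, ((S \ S').card : ℝ) = S.card - (S' ∩ S).card := fun S' => by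
    have := Finset.card_sdiff_add_card_inter S S'
    rw [Finset.inter_comm] at this
    rw [← this]
    push_cast
    ring
  simp_rw [h, mul_sub, Finset.sum_sub_distrib, ← Finset.sum_mul, sum_stepProb,
    sum_stepProb_mul_card_inter]
  linarith [G.weight_self_add_weight_compl S]

lemma sum_stepProb_mul_card_symmDiff (S : Finset V) :
    ∑ S' : Finset V, G.stepProb S S' * ((symmDiff S S').card : ℝ) = 2 * G.weight S Sᶜ := by
  have h : ∀ S' : Finset V, ((symmDiff S S').card : ℝ) = (S \ S').card + (S' \ S).card :=
    fun S' => by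
      rw [symmDiff_def, Finset.sup_eq_union, Finset.card_union_of_disjoint disjoint_sdiff_sdiff]
      push_cast
      rfl
  simp_rw [h, mul_add, Finset.sum_add_distrib, sum_stepProb_mul_card_sdiff,
    sum_stepProb_mul_card_sdiff']
  ring

lemma nextSet_anti (S : Finset V) {u u' : ℝ} (h : u ≤ u') : G.nextSet S u' ⊆ G.nextSet S u := by
  intro y
  simp only [nextSet, Finset.mem_filter, Finset.mem_univ, true_and]
  exact h.trans

variable {G}

lemma IsLazy.weight_singleton_ge (hG : G.IsLazy) {S : Finset V} {y : V} (hy : y ∈ S) :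
    1 / 2 ≤ G.weight {y} S := by
  refine (hG y).trans ?_
  simpa [weight] using
    Finset.single_le_sum (f := fun j => G.w y j) (fun j _ => G.nonneg y j) hy

lemma IsLazy.weight_singleton_le (hG : G.IsLazy) {S : Finset V} {y : V} (hy : y ∉ S) :
    G.weight {y} S ≤ 1 / 2 := by
  have h := Finset.sum_le_univ_sum_of_nonneg (s := insert y S) (fun j => G.nonneg y j)
  rw [Finset.sum_insert hy, G.degree_eq_one] at h
  have : G.weight {y} S = ∑ j ∈ S, G.w y j := by simp [weight]
  linarith [hG y]

/-- By laziness the threshold `1 / 2` separates the vertices of `S` from the others: lower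
thresholds keep all of `S`, higher ones add nothing. -/
lemma IsLazy.subset_or_subset (hG : G.IsLazy) {S S' : Finset V} (h : G.stepProb S S' ≠ 0) :
    S ⊆ S' ∨ S' ⊆ S := by
  obtain ⟨u, hu, rfl⟩ := G.exists_eq_nextSet h
  rcases le_or_gt u (1 / 2) with h2 | h2
  · left
    intro y hy
    simpa [nextSet] using h2.trans (hG.weight_singleton_ge hy)
  · right
    intro y hy
    simp only [nextSet, Finset.mem_filter, Finset.mem_univ, true_and] at hy
    by_contra hyS
    linarith [hG.weight_singleton_le hyS]

variable (G)

lemma halfBoundary_le {S T : Finset V} (hT : T ⊆ Sᶜ)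
    (h : G.weight S Sᶜ / 2 ≤ G.weight S T) : G.halfBoundary S ≤ T.card :=
  Nat.sInf_le ⟨T, hT, rfl, h⟩

lemma exists_halfBoundary (S : Finset V) :
    ∃ T : Finset V, T ⊆ Sᶜ ∧ T.card = G.halfBoundary S ∧ G.weight S Sᶜ / 2 ≤ G.weight S T :=
  Nat.sInf_mem (s := {m : ℕ | ∃ T : Finset V, T ⊆ Sᶜ ∧ T.card = m ∧
    G.weight S Sᶜ / 2 ≤ G.weight S T})
    ⟨_, Sᶜ, subset_rfl, rfl, by linarith [G.weight_nonneg S Sᶜ]⟩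

/-- At least half of the expected growth comes from steps that add at least `N_{1/2}(S)`
vertices. -/
lemma half_weight_le_sum_stepProb (S : Finset V) :
    G.weight S Sᶜ / 2 ≤ ∑ S' : Finset V with G.halfBoundary S ≤ (S' \ S).card,
      G.stepProb S S' * ((S' \ S).card : ℝ) := by
  have hsplit := Finset.sum_filter_add_sum_filter_not (Finset.univ : Finset (Finset V))
    (fun S' => G.halfBoundary S ≤ (S' \ S).card)
    (fun S' => G.stepProb S S' * ((S' \ S).card : ℝ))
  rw [sum_stepProb_mul_card_sdiff] at hsplit
  suffices h : ∑ S' : Finset V with ¬ G.halfBoundary S ≤ (S' \ S).card,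
      G.stepProb S S' * ((S' \ S).card : ℝ) ≤ G.weight S Sᶜ / 2 by linarith
  set F := (Finset.univ : Finset (Finset V)).filter
    fun S' => ¬ G.halfBoundary S ≤ (S' \ S).card ∧ G.stepProb S S' ≠ 0 with hF
  have hFsum : ∑ S' : Finset V with ¬ G.halfBoundary S ≤ (S' \ S).card,
      G.stepProb S S' * ((S' \ S).card : ℝ) =
      ∑ S' ∈ F, G.stepProb S S' * ((S' \ S).card : ℝ) := by
    symm
    refine Finset.sum_subset (fun S' h => by simp_all) fun S' h h' => ?_
    have : G.stepProb S S' = 0 := by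
      by_contra h0
      exact h' (by simp_all)
    simp [this]
  rw [hFsum]
  rcases F.eq_empty_or_nonempty with h0 | hne
  · rw [h0]
    simpa using div_nonneg (G.weight_nonneg S Sᶜ) zero_le_two
  -- The possible successors form a chain, so the largest one among those adding fewer than
  -- `N_{1/2}(S)` vertices contains all the others; by minimality of `N_{1/2}(S)`, its new vertices
  -- receive at most half of the boundary weight.
  obtain ⟨M, hM, hmax⟩ := Finset.exists_max_image F (fun S' => S'.card) hne
  have hMF := hM
  simp only [hF, Finset.mem_filter, Finset.mem_univ, true_and] at hM
  have hsub : ∀ S' ∈ F, S' ⊆ M := fun S' hS' => by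
    have hc := hmax S' hS'
    simp only [hF, Finset.mem_filter, Finset.mem_univ, true_and] at hS'
    obtain ⟨u, _, rfl⟩ := G.exists_eq_nextSet hS'.2
    obtain ⟨u', _, rfl⟩ := G.exists_eq_nextSet hM.2
    rcases le_total u' u with h | h
    · exact G.nextSet_anti S h
    · exact (Finset.eq_of_subset_of_card_le (G.nextSet_anti S h) hc).superset
  have hT : G.weight S (M \ S) ≤ G.weight S Sᶜ / 2 := by
    by_contra! h
    refine hM.1 (G.halfBoundary_le (fun y hy => ?_) h.le)
    simpa using (Finset.mem_sdiff.1 hy).2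
  calc ∑ S' ∈ F, G.stepProb S S' * ((S' \ S).card : ℝ)
      ≤ ∑ S' ∈ F, G.stepProb S S' * ((S' ∩ (M \ S)).card : ℝ) := by
        refine Finset.sum_le_sum fun S' hS' => ?_
        refine mul_le_mul_of_nonneg_left ?_ (G.stepProb_nonneg S S')
        exact_mod_cast Finset.card_le_card fun y hy => by
          have := Finset.mem_sdiff.1 hy
          simp [this.1, this.2, hsub S' hS' this.1]
    _ ≤ ∑ S' : Finset V, G.stepProb S S' * ((S' ∩ (M \ S)).card : ℝ) :=
        Finset.sum_le_univ_sum_of_nonneg fun S' =>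
          mul_nonneg (G.stepProb_nonneg S S') (Nat.cast_nonneg _)
    _ = G.weight S (M \ S) := G.sum_stepProb_mul_card_inter S _
    _ ≤ _ := hT

lemma expansion_nonneg (S : Finset V) : 0 ≤ G.expansion S :=
  div_nonneg (G.weight_nonneg _ _) (Nat.cast_nonneg _)

lemma vertexExpansion_nonneg (S : Finset V) : 0 ≤ G.vertexExpansion S :=
  le_min (by positivity) zero_le_one

variable {G}

/-- The growth gauge: the expectation of `√(|S'| / |S|)` is at most `1 - Ψ(S) / 24`. -/
lemma IsLazy.sum_stepProb_mul_sqrt_le (hG : G.IsLazy) {S : Finset V} (hS : S.Nonempty) :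
    ∑ S' : Finset V, G.stepProb S S' * √((S'.card : ℝ) / S.card) ≤ 1 - G.Psi S / 24 := by
  have hS0 : (0 : ℝ) < S.card := by exact_mod_cast hS.card_pos
  -- With `r = |S'| / |S|` one has `√r = (1 + r) / 2 - (√r - 1)² / 2`, and `r` has mean `1`; so only
  -- the mean of `(√r - 1)²` has to be bounded below, and the steps of large growth are enough for
  -- that.
  have hsum : ∑ S' : Finset V, G.stepProb S S' * √((S'.card : ℝ) / S.card) =
      1 - (∑ S' : Finset V, G.stepProb S S' * (√((S'.card : ℝ) / S.card) - 1) ^ 2) / 2 := by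
    have h1 : ∀ S' : Finset V, G.stepProb S S' * √((S'.card : ℝ) / S.card) =
        G.stepProb S S' * (1 / 2) + G.stepProb S S' * (S'.card : ℝ) / (2 * S.card) -
        G.stepProb S S' * (√((S'.card : ℝ) / S.card) - 1) ^ 2 / 2 := fun S' => by
      have h2 := Real.sq_sqrt (show (0 : ℝ) ≤ (S'.card : ℝ) / S.card by positivity)
      linear_combination (G.stepProb S S' / 2) * h2
    rw [Finset.sum_congr rfl fun S' _ => h1 S', Finset.sum_sub_distrib, Finset.sum_add_distrib,
      ← Finset.sum_div, ← Finset.sum_div, ← Finset.sum_mul, sum_stepProb, sum_stepProb_mul_card]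
    field_simp
    ring
  rw [hsum]
  suffices h : G.Psi S / 12 ≤
      ∑ S' : Finset V, G.stepProb S S' * (√((S'.card : ℝ) / S.card) - 1) ^ 2 by linarith
  have hhalf := G.half_weight_le_sum_stepProb S
  calc G.Psi S / 12 = G.weight S Sᶜ / 2 * (G.vertexExpansion S / (6 * S.card)) := by
        unfold Psi expansion
        field_simp
        ring
    _ ≤ (∑ S' : Finset V with G.halfBoundary S ≤ (S' \ S).card,
          G.stepProb S S' * ((S' \ S).card : ℝ)) * (G.vertexExpansion S / (6 * S.card)) :=
        mul_le_mul_of_nonneg_right hhalf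
          (div_nonneg (G.vertexExpansion_nonneg S) (by positivity))
    _ = ∑ S' : Finset V with G.halfBoundary S ≤ (S' \ S).card,
          G.stepProb S S' * (((S' \ S).card : ℝ) / S.card * G.vertexExpansion S / 6) := by
        rw [Finset.sum_mul]
        refine Finset.sum_congr rfl fun S' _ => ?_
        field_simp
    _ ≤ ∑ S' : Finset V with G.halfBoundary S ≤ (S' \ S).card,
          G.stepProb S S' * (√((S'.card : ℝ) / S.card) - 1) ^ 2 := by
        refine Finset.sum_le_sum fun S' hS' => ?_
        have hS'' : G.halfBoundary S ≤ (S' \ S).card := by simpa using hS'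
        rcases eq_or_ne (G.stepProb S S') 0 with h0 | h0
        · simp [h0]
        refine mul_le_mul_of_nonneg_left ?_ (G.stepProb_nonneg S S')
        rcases hG.subset_or_subset h0 with hsub | hsub
        · set f : ℝ := ((S' \ S).card : ℝ) / S.card with hf
          have hf0 : 0 ≤ f := by positivity
          have hr : (S'.card : ℝ) / S.card = 1 + f := by
            rw [hf, Finset.cast_card_sdiff hsub]
            field_simp
            ring
          rw [hr]
          refine le_trans ?_ (Real.mul_min_le_sqrt_sub_one_sq hf0)
          have : G.vertexExpansion S ≤ min f 1 := by
            refine min_le_min_right _ ?_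
            rw [hf]
            gcongr
          gcongr
        · rw [Finset.sdiff_eq_empty_iff_subset.2 hsub]
          simpa using sq_nonneg _
    _ ≤ _ := Finset.sum_le_univ_sum_of_nonneg fun S' =>
          mul_nonneg (G.stepProb_nonneg S S') (sq_nonneg _)

lemma IsLazy.expansion_le_half (hG : G.IsLazy) (S : Finset V) : G.expansion S ≤ 1 / 2 := by
  unfold expansion
  rcases S.eq_empty_or_nonempty with rfl | hS
  · simp
  have hS0 : (0 : ℝ) < S.card := by exact_mod_cast hS.card_pos
  rw [div_le_iff₀ hS0]
  have h1 : (S.card : ℝ) / 2 ≤ G.weight S S := by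
    rw [← sum_weight_singleton_eq]
    calc (S.card : ℝ) / 2 = ∑ y ∈ S, (1 / 2 : ℝ) := by simp; ring
      _ ≤ _ := Finset.sum_le_sum fun y hy => hG.weight_singleton_ge hy
  linarith [G.weight_self_add_weight_compl S]

/-- A lazy outside vertex receives at most `1 / 2` from `S`, so receiving half of `w(S, Sᶜ)` takes
at least `w(S, Sᶜ)` vertices. Hence `φ ≤ φ^V`. -/
lemma IsLazy.expansion_sq_le_Psi (hG : G.IsLazy) (S : Finset V) :
    G.expansion S ^ 2 ≤ G.Psi S := by
  rw [sq, Psi]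
  refine mul_le_mul_of_nonneg_left ?_ (G.expansion_nonneg S)
  refine le_min ?_ (by linarith [hG.expansion_le_half S])
  unfold expansion
  refine div_le_div_of_nonneg_right ?_ (Nat.cast_nonneg _)
  obtain ⟨T, hT, hc, hw⟩ := G.exists_halfBoundary S
  have : G.weight S T ≤ (T.card : ℝ) / 2 := by
    rw [← sum_weight_singleton_eq]
    calc _ ≤ ∑ y ∈ T, (1 / 2 : ℝ) := Finset.sum_le_sum fun y hy =>
            hG.weight_singleton_le (by simpa using hT hy)
      _ = (T.card : ℝ) / 2 := by simp; ring
  rw [← hc]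
  linarith

/-! ### The volume-biased process -/

variable (G)

/-- The transition probability of the volume-biased process as a real number. -/
def biasedProb (S S' : Finset V) : ℝ := (S'.card : ℝ) * G.stepProb S S' / S.card

lemma biasedProb_nonneg (S S' : Finset V) : 0 ≤ G.biasedProb S S' :=
  div_nonneg (mul_nonneg (Nat.cast_nonneg _) (G.stepProb_nonneg _ _)) (Nat.cast_nonneg _)

lemma biasedStep_apply {S : Finset V} (hS : S.Nonempty) (S' : Finset V) :
    G.biasedStep S S' = ENNReal.ofReal (G.biasedProb S S') := by
  have hS0 : (0 : ℝ) < S.card := by exact_mod_cast hS.card_pos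
  rw [biasedStep, dif_pos hS, PMF.ofFintype_apply, biasedProb, ENNReal.ofReal_div_of_pos hS0,
    ENNReal.ofReal_mul (Nat.cast_nonneg _), ofReal_stepProb, ENNReal.ofReal_natCast,
    ENNReal.ofReal_natCast]

lemma sum_biasedProb {S : Finset V} (hS : S.Nonempty) :
    ∑ S' : Finset V, G.biasedProb S S' = 1 := by
  have hS0 : (0 : ℝ) < S.card := by exact_mod_cast hS.card_pos
  unfold biasedProb
  rw [← Finset.sum_div, Finset.sum_congr rfl fun S' _ => mul_comm _ _, sum_stepProb_mul_card,
    div_self hS0.ne']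

lemma biasedProb_empty (S : Finset V) : G.biasedProb S ∅ = 0 := by simp [biasedProb]

/-- The size bias cancels the normalisation of the average, and duality applies: a uniform vertex of
the biased process has the law of the random walk. -/
lemma sum_biasedProb_mul_average {S : Finset V} (f : V → ℝ) :
    ∑ S' : Finset V, G.biasedProb S S' * ((∑ y ∈ S', f y) / S'.card) =
      (∑ x ∈ S, ∑ y, G.w x y * f y) / S.card := by
  have h : ∀ S' : Finset V, G.biasedProb S S' * ((∑ y ∈ S', f y) / S'.card) =
      G.stepProb S S' * (∑ y ∈ S', f y) / S.card := fun S' => by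
    rcases S'.eq_empty_or_nonempty with rfl | hS'
    · simp
    have : (0 : ℝ) < S'.card := by exact_mod_cast hS'.card_pos
    unfold biasedProb
    field_simp
  rw [Finset.sum_congr rfl fun S' _ => h S', ← Finset.sum_div, sum_stepProb_mul_sum,
    Finset.sum_comm]
  congr 1
  refine Finset.sum_congr rfl fun y _ => ?_
  simp only [weight, Finset.sum_singleton]
  rw [Finset.sum_mul]
  exact Finset.sum_congr rfl fun x _ => by rw [G.symm]

/-- Dividing by `|S'|` undoes the size bias. Only an inequality, as the unbiased process may also
jump to `∅`. -/
lemma sum_biasedProb_mul_symmDiff (S : Finset V) :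
    ∑ S' : Finset V, G.biasedProb S S' * ((symmDiff S S').card / S'.card : ℝ) ≤
      2 * G.expansion S := by
  have h : ∀ S' : Finset V, G.biasedProb S S' * ((symmDiff S S').card / S'.card : ℝ) ≤
      G.stepProb S S' * ((symmDiff S S').card : ℝ) / S.card := fun S' => by
    rcases S'.eq_empty_or_nonempty with rfl | hS'
    · rw [biasedProb_empty, zero_mul]
      exact div_nonneg (mul_nonneg (G.stepProb_nonneg _ _) (Nat.cast_nonneg _)) (Nat.cast_nonneg _)
    have : (0 : ℝ) < S'.card := by exact_mod_cast hS'.card_pos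
    unfold biasedProb
    apply le_of_eq
    field_simp
  refine (Finset.sum_le_sum fun S' _ => h S').trans_eq ?_
  rw [← Finset.sum_div, sum_stepProb_mul_card_symmDiff, expansion]
  ring

variable {G}

lemma IsLazy.sum_biasedProb_mul_sqrt_le (hG : G.IsLazy) {S : Finset V} (hS : S.Nonempty) :
    ∑ S' : Finset V, G.biasedProb S S' * √((S.card : ℝ) / S'.card) ≤ 1 - G.Psi S / 24 := by
  refine le_trans (le_of_eq ?_) (hG.sum_stepProb_mul_sqrt_le hS)
  have hS0 : (0 : ℝ) < S.card := by exact_mod_cast hS.card_pos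
  refine Finset.sum_congr rfl fun S' _ => ?_
  rcases S'.eq_empty_or_nonempty with rfl | hS'
  · simp
  have hS'0 : (0 : ℝ) < S'.card := by exact_mod_cast hS'.card_pos
  unfold biasedProb
  rw [Real.sqrt_div hS0.le, Real.sqrt_div hS'0.le]
  have h1 := Real.sqrt_pos.2 hS0
  have h2 := Real.sqrt_pos.2 hS'0
  have h3 := Real.sq_sqrt hS0.le
  have h4 := Real.sq_sqrt hS'0.le
  field_simp
  rw [h3, h4]
  ring

/-- Apply `log x ≤ x - 1` to `x = √(|S| / |S'|)`. This drift is what pays for the volume of changes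
in the cost bound. -/
lemma IsLazy.le_sum_biasedProb_mul_log (hG : G.IsLazy) {S : Finset V} (hS : S.Nonempty) :
    Real.log S.card + G.expansion S ^ 2 / 12 ≤
      ∑ S' : Finset V, G.biasedProb S S' * Real.log S'.card := by
  have hS0 : (0 : ℝ) < S.card := by exact_mod_cast hS.card_pos
  have h : ∀ S' : Finset V, G.biasedProb S S' * (Real.log S.card + 2) -
      2 * (G.biasedProb S S' * √((S.card : ℝ) / S'.card)) ≤
      G.biasedProb S S' * Real.log S'.card := fun S' => by
    rcases S'.eq_empty_or_nonempty with rfl | hS'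
    · simp [biasedProb_empty]
    have hS'0 : (0 : ℝ) < S'.card := by exact_mod_cast hS'.card_pos
    have h1 := Real.log_le_sub_one_of_pos
      (Real.sqrt_pos.2 (div_pos hS0 hS'0))
    rw [Real.log_sqrt (div_pos hS0 hS'0).le, Real.log_div hS0.ne' hS'0.ne'] at h1
    nlinarith [G.biasedProb_nonneg S S']
  have hsum := Finset.sum_le_sum fun S' (_ : S' ∈ (Finset.univ : Finset (Finset V))) => h S'
  rw [Finset.sum_sub_distrib, ← Finset.sum_mul, ← Finset.mul_sum, G.sum_biasedProb hS] at hsum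
  linarith [hG.sum_biasedProb_mul_sqrt_le hS, hG.expansion_sq_le_Psi S]

end RegularGraph
end

/-! ### The random walk killed outside a set, and its staying probability. -/

noncomputable section

section Spectral

open scoped RealInnerProductSpace

variable {E : Type*} [NormedAddCommGroup E] [InnerProductSpace ℝ E] [FiniteDimensional ℝ E]

/-- If `z` has Rayleigh quotient at least `1 - φ` and `x` is an orthogonal part of `z` with
at least half of the squared norm, then the powers of `T` do not contract `x` by much more than
`1 - 8φ` per step. -/
lemma LinearMap.IsSymmetric.pow_mul_norm_sq_le_inner_pow {T : E →ₗ[ℝ] E} (hT : T.IsSymmetric)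
    (h0 : ∀ u, 0 ≤ ⟪u, T u⟫) (h1 : ∀ u, ⟪u, T u⟫ ≤ ‖u‖ ^ 2) {x z : E} {φ : ℝ} (hφ : 0 < φ)
    (hφ8 : 8 * φ ≤ 1) (hx : x ≠ 0) (hxz : ⟪x, z⟫ = ‖x‖ ^ 2) (hz : ‖z‖ ^ 2 ≤ 2 * ‖x‖ ^ 2)
    (hR : (1 - φ) * ‖z‖ ^ 2 ≤ ⟪z, T z⟫) (t : ℕ) :
    (1 - 8 * φ) ^ t * (‖x‖ ^ 2 / 8) ≤ ⟪x, (T ^ t) x⟫ := by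
  set b := hT.eigenvectorBasis rfl with hb
  set l := hT.eigenvalues rfl with hl
  have hnorm : ∀ u : E, ∑ i, ⟪b i, u⟫ ^ 2 = ‖u‖ ^ 2 := fun u => by
    simpa using b.sum_sq_norm_inner_right u
  have happ : ∀ u i, ⟪b i, T u⟫ = l i * ⟪b i, u⟫ := fun u i => by
    have := hT.eigenvectorBasis_apply_self_apply rfl u i
    simpa [OrthonormalBasis.repr_apply_apply] using this
  have hpow : ∀ (s : ℕ) i u, ⟪b i, (T ^ s) u⟫ = l i ^ s * ⟪b i, u⟫ := fun s i => by
    induction s with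
    | zero => simp
    | succ s ih =>
      intro u
      rw [pow_succ', Module.End.mul_apply, happ, ih]
      ring
  have hl_eq : ∀ i, ⟪b i, T (b i)⟫ = l i := fun i => by
    rw [happ, real_inner_self_eq_norm_sq, b.norm_eq_one]
    ring
  have hl0 : ∀ i, 0 ≤ l i := fun i => (h0 (b i)).trans_eq (hl_eq i)
  have hl1 : ∀ i, l i ≤ 1 := fun i => by
    have := h1 (b i)
    rw [hl_eq, b.norm_eq_one] at this
    simpa using this
  have hinner : ∀ u v : E, ∑ i, ⟪b i, u⟫ * ⟪b i, v⟫ = ⟪u, v⟫ := fun u v => by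
    rw [← b.sum_inner_mul_inner u v]
    exact Finset.sum_congr rfl fun i _ => by rw [real_inner_comm u]
  set H := (Finset.univ.filter fun i => 1 - 8 * φ ≤ l i) with hH
  set X := ‖x‖ ^ 2 with hX
  set Z := ‖z‖ ^ 2 with hZ
  have hXpos : 0 < X := by positivity
  -- Markov's inequality for the spectral measure of `z`: the mean of `1 - l` is at most `φ`, so at
  -- most `1 / 8` of the mass has `1 - l > 8φ`.
  have hlow : ∑ i ∈ Hᶜ, ⟪b i, z⟫ ^ 2 ≤ Z / 8 := by
    have e1 : ∑ i, (1 - l i) * ⟪b i, z⟫ ^ 2 ≤ φ * Z := by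
      have : ∑ i, l i * ⟪b i, z⟫ ^ 2 = ⟪z, T z⟫ := by
        rw [← hinner]
        exact Finset.sum_congr rfl fun i _ => by rw [happ]; ring
      simp_rw [sub_mul, one_mul, Finset.sum_sub_distrib]
      rw [hnorm, this]
      linarith
    have e2 : 8 * φ * ∑ i ∈ Hᶜ, ⟪b i, z⟫ ^ 2 ≤ ∑ i, (1 - l i) * ⟪b i, z⟫ ^ 2 := by
      rw [Finset.mul_sum]
      refine (Finset.sum_le_sum fun i hi => ?_).trans
        (Finset.sum_le_univ_sum_of_nonneg (s := Hᶜ) fun i =>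
          mul_nonneg (sub_nonneg.2 (hl1 i)) (sq_nonneg _))
      have : l i < 1 - 8 * φ := by
        simpa only [hH, Finset.mem_compl, Finset.mem_filter, Finset.mem_univ, true_and, not_le]
          using hi
      exact mul_le_mul_of_nonneg_right (by linarith) (sq_nonneg _)
    have := e2.trans e1
    nlinarith
  -- Cauchy–Schwarz: the square is at most `X · Z / 8 ≤ (X / 2)²`, because `Z ≤ 2 X`. The high part
  -- then carries the other half of `⟪x, z⟫ = X`, and Cauchy–Schwarz there gives `x` the mass `(X /
  -- 2)² / (2 X) = X / 8`.
  have hcross : (∑ i ∈ Hᶜ, ⟪b i, x⟫ * ⟪b i, z⟫) ≤ X / 2 := by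
    have e := Finset.sum_mul_sq_le_sq_mul_sq Hᶜ (fun i => ⟪b i, x⟫) (fun i => ⟪b i, z⟫)
    have e' : ∑ i ∈ Hᶜ, ⟪b i, x⟫ ^ 2 ≤ X :=
      (Finset.sum_le_univ_sum_of_nonneg fun i => sq_nonneg _).trans_eq (hnorm x)
    refine abs_le_of_sq_le_sq' (e.trans ?_) (by positivity) |>.2
    calc _ ≤ X * (Z / 8) := mul_le_mul e' hlow (Finset.sum_nonneg fun i _ => sq_nonneg _)
            hXpos.le
      _ ≤ (X / 2) ^ 2 := by nlinarith
  have hhigh : X / 2 ≤ ∑ i ∈ H, ⟪b i, x⟫ * ⟪b i, z⟫ := by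
    have := Finset.sum_add_sum_compl H fun i => ⟪b i, x⟫ * ⟪b i, z⟫
    rw [hinner, hxz] at this
    linarith
  have hmass : X / 8 ≤ ∑ i ∈ H, ⟪b i, x⟫ ^ 2 := by
    have e := Finset.sum_mul_sq_le_sq_mul_sq H (fun i => ⟪b i, x⟫) (fun i => ⟪b i, z⟫)
    have e' : ∑ i ∈ H, ⟪b i, z⟫ ^ 2 ≤ 2 * X :=
      ((Finset.sum_le_univ_sum_of_nonneg fun i => sq_nonneg _).trans_eq (hnorm z)).trans hz
    have e0 : 0 ≤ ∑ i ∈ H, ⟪b i, x⟫ ^ 2 := Finset.sum_nonneg fun i _ => sq_nonneg _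
    have e3 : (X / 2) ^ 2 ≤ (∑ i ∈ H, ⟪b i, x⟫ ^ 2) * (2 * X) :=
      (pow_le_pow_left₀ (by positivity) hhigh 2).trans
        (e.trans (mul_le_mul_of_nonneg_left e' e0))
    nlinarith
  calc (1 - 8 * φ) ^ t * (X / 8) ≤ (1 - 8 * φ) ^ t * ∑ i ∈ H, ⟪b i, x⟫ ^ 2 :=
        mul_le_mul_of_nonneg_left hmass (pow_nonneg (by linarith) t)
    _ ≤ ∑ i ∈ H, l i ^ t * ⟪b i, x⟫ ^ 2 := by
        rw [Finset.mul_sum]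
        refine Finset.sum_le_sum fun i hi => mul_le_mul_of_nonneg_right
          (pow_le_pow_left₀ (by linarith) (by simpa [hH] using hi) t) (sq_nonneg _)
    _ ≤ ∑ i, l i ^ t * ⟪b i, x⟫ ^ 2 := Finset.sum_le_univ_sum_of_nonneg fun i =>
        mul_nonneg (pow_nonneg (hl0 i) t) (sq_nonneg _)
    _ = ⟪x, (T ^ t) x⟫ := by
        rw [← hinner]
        exact Finset.sum_congr rfl fun i _ => by rw [hpow]; ring

end Spectral

namespace RegularGraph

variable {V : Type*} [Fintype V] [DecidableEq V] (G : RegularGraph V)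

/-- The probability that `t` steps of the random walk, from a given vertex, all stay in `A`. -/
def stayProb (A : Finset V) : ℕ → V → ℝ
  | 0, x => if x ∈ A then 1 else 0
  | t + 1, x => if x ∈ A then ∑ y, G.w x y * stayProb A t y else 0

lemma stayProb_of_notMem {A : Finset V} {x : V} (hx : x ∉ A) (t : ℕ) :
    G.stayProb A t x = 0 := by
  cases t <;> simp [stayProb, hx]

lemma stayProb_nonneg (A : Finset V) (t : ℕ) (x : V) : 0 ≤ G.stayProb A t x := by
  induction t generalizing x with
  | zero => unfold stayProb; split_ifs <;> simp
  | succ t ih =>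
    unfold stayProb
    split_ifs
    · exact Finset.sum_nonneg fun y _ => mul_nonneg (G.nonneg x y) (ih y)
    · rfl

lemma stayProb_le_one (A : Finset V) (t : ℕ) (x : V) : G.stayProb A t x ≤ 1 := by
  induction t generalizing x with
  | zero => unfold stayProb; split_ifs <;> simp
  | succ t ih =>
    unfold stayProb
    split_ifs
    · rw [← G.degree_eq_one x]
      exact Finset.sum_le_sum fun y _ => mul_le_of_le_one_right (G.nonneg x y) (ih y)
    · exact zero_le_one

lemma sum_stayProb_le (A S : Finset V) (t : ℕ) : ∑ x ∈ S, G.stayProb A t x ≤ A.card := by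
  calc ∑ x ∈ S, G.stayProb A t x ≤ ∑ x, G.stayProb A t x :=
        Finset.sum_le_univ_sum_of_nonneg fun x => G.stayProb_nonneg A t x
    _ ≤ ∑ x, if x ∈ A then (1 : ℝ) else 0 := Finset.sum_le_sum fun x _ => by
        split_ifs with h
        · exact G.stayProb_le_one A t x
        · exact (G.stayProb_of_notMem h t).le
    _ = A.card := by simp

variable {G} in
lemma IsLazy.pow_le_stayProb (hG : G.IsLazy) {A : Finset V} {x : V} (hx : x ∈ A) (t : ℕ) :
    (1 / 2 : ℝ) ^ t ≤ G.stayProb A t x := by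
  induction t with
  | zero => simp [stayProb, hx]
  | succ t ih =>
    rw [stayProb, if_pos hx]
    calc (1 / 2 : ℝ) ^ (t + 1) = 1 / 2 * (1 / 2) ^ t := by ring
      _ ≤ G.w x x * G.stayProb A t x := mul_le_mul (hG x) ih (by positivity) (G.nonneg x x)
      _ ≤ _ := Finset.single_le_sum (f := fun y => G.w x y * G.stayProb A t y)
          (fun y _ => mul_nonneg (G.nonneg x y) (G.stayProb_nonneg A t y)) (Finset.mem_univ x)

lemma sum_sum_w_mul_sq (v : V → ℝ) : ∑ x, ∑ y, G.w x y * v x ^ 2 = ∑ x, v x ^ 2 := by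
  refine Finset.sum_congr rfl fun x _ => ?_
  rw [← Finset.sum_mul, G.degree_eq_one, one_mul]

lemma sum_sum_w_mul_sq' (v : V → ℝ) : ∑ x, ∑ y, G.w x y * v y ^ 2 = ∑ x, v x ^ 2 := by
  rw [Finset.sum_comm, ← G.sum_sum_w_mul_sq v]
  exact Finset.sum_congr rfl fun x _ => Finset.sum_congr rfl fun y _ => by rw [G.symm]

lemma sum_sum_w_mul_mul_le (v : V → ℝ) :
    ∑ x, ∑ y, G.w x y * (v x * v y) ≤ ∑ x, v x ^ 2 := by
  have h : ∑ x, ∑ y, G.w x y * (v x * v y) ≤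
      ∑ x, ∑ y, (G.w x y * v x ^ 2 / 2 + G.w x y * v y ^ 2 / 2) :=
    Finset.sum_le_sum fun x _ => Finset.sum_le_sum fun y _ => by
      nlinarith [mul_nonneg (G.nonneg x y) (sq_nonneg (v x - v y))]
  simp_rw [Finset.sum_add_distrib, ← Finset.sum_div, sum_sum_w_mul_sq, sum_sum_w_mul_sq'] at h
  linarith

variable {G} in
-- Expand `∑ w(x, y) (v x + v y)² / 2`; its diagonal terms alone are at least `∑ v x²`, by laziness.
-- Thus the killed walk has no negative eigenvalues.
lemma IsLazy.sum_sum_w_mul_mul_nonneg (hG : G.IsLazy) (v : V → ℝ) :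
    0 ≤ ∑ x, ∑ y, G.w x y * (v x * v y) := by
  have h : ∑ x, v x ^ 2 ≤ ∑ x, ∑ y, G.w x y * (v x + v y) ^ 2 / 2 :=
    Finset.sum_le_sum fun x _ => by
      refine le_trans ?_ (Finset.single_le_sum (f := fun y => G.w x y * (v x + v y) ^ 2 / 2)
        (fun y _ => div_nonneg (mul_nonneg (G.nonneg x y) (sq_nonneg _)) zero_le_two)
        (Finset.mem_univ x))
      nlinarith [hG x, sq_nonneg (v x)]
  have h2 : ∑ x, ∑ y, G.w x y * (v x + v y) ^ 2 / 2 =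
      ∑ x, ∑ y, (G.w x y * v x ^ 2 / 2 + G.w x y * v y ^ 2 / 2 + G.w x y * (v x * v y)) :=
    Finset.sum_congr rfl fun x _ => Finset.sum_congr rfl fun y _ => by ring
  simp_rw [Finset.sum_add_distrib, ← Finset.sum_div, sum_sum_w_mul_sq, sum_sum_w_mul_sq'] at h2
  simp_rw [← Finset.sum_div] at h
  linarith

/-- The transition operator of the random walk killed outside of `A`. -/
def killedWalk (A : Finset V) : EuclideanSpace ℝ V →ₗ[ℝ] EuclideanSpace ℝ V :=
  Matrix.toEuclideanLin (Matrix.of fun x y => if x ∈ A ∧ y ∈ A then G.w x y else 0)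

lemma killedWalk_apply (A : Finset V) (u : EuclideanSpace ℝ V) (x : V) :
    G.killedWalk A u x = ∑ y, (if x ∈ A ∧ y ∈ A then G.w x y else 0) * u y := by
  simp [killedWalk, Matrix.toLpLin_apply, Matrix.mulVec, dotProduct]

lemma inner_killedWalk (A : Finset V) (u v : EuclideanSpace ℝ V) :
    inner ℝ u (G.killedWalk A v) = ∑ x, ∑ y,
      G.w x y * ((if x ∈ A then u x else 0) * (if y ∈ A then v y else 0)) := by
  rw [PiLp.inner_apply]
  refine Finset.sum_congr rfl fun x _ => ?_
  rw [killedWalk_apply]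
  simp only [RCLike.inner_apply, conj_trivial, Finset.sum_mul]
  refine Finset.sum_congr rfl fun y _ => ?_
  by_cases hx : x ∈ A <;> by_cases hy : y ∈ A <;> simp [hx, hy]
  ring

lemma isSymmetric_killedWalk (A : Finset V) : (G.killedWalk A).IsSymmetric := fun u v => by
  rw [real_inner_comm, inner_killedWalk, inner_killedWalk, Finset.sum_comm]
  exact Finset.sum_congr rfl fun x _ => Finset.sum_congr rfl fun y _ => by rw [G.symm]; ring

lemma inner_killedWalk_le (A : Finset V) (u : EuclideanSpace ℝ V) :
    inner ℝ u (G.killedWalk A u) ≤ ‖u‖ ^ 2 := by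
  rw [inner_killedWalk, EuclideanSpace.real_norm_sq_eq]
  refine (G.sum_sum_w_mul_mul_le _).trans (Finset.sum_le_sum fun x _ => ?_)
  split_ifs
  · rfl
  · simpa using sq_nonneg (u x)

/-- The indicator vector of a set. -/
def indVec (B : Finset V) : EuclideanSpace ℝ V := WithLp.toLp 2 fun x => if x ∈ B then 1 else 0

lemma indVec_apply (B : Finset V) (x : V) : (indVec B) x = if x ∈ B then 1 else 0 := rfl

lemma norm_indVec_sq (B : Finset V) : ‖indVec B‖ ^ 2 = (B.card : ℝ) := by
  rw [EuclideanSpace.real_norm_sq_eq]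
  simp [indVec_apply]

lemma inner_indVec (B : Finset V) (u : EuclideanSpace ℝ V) :
    inner ℝ (indVec B) u = ∑ x ∈ B, u x := by
  rw [PiLp.inner_apply]
  simp [indVec_apply]

lemma killedWalk_pow_indVec_le {A B : Finset V} (hB : B ⊆ A) (t : ℕ) (x : V) :
    ((G.killedWalk A) ^ t) (indVec B) x ≤ G.stayProb A t x := by
  induction t generalizing x with
  | zero =>
    simp only [pow_zero, Module.End.one_apply, indVec_apply, stayProb]
    by_cases h1 : x ∈ B
    · simp [h1, hB h1]
    · simp only [h1, if_false]
      split_ifs <;> simp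
  | succ t ih =>
    rw [pow_succ', Module.End.mul_apply, killedWalk_apply, stayProb]
    by_cases hx : x ∈ A
    · simp only [hx, true_and, if_true]
      refine Finset.sum_le_sum fun y _ => ?_
      by_cases hy : y ∈ A
      · simpa [hy] using mul_le_mul_of_nonneg_left (ih y) (G.nonneg x y)
      · simp [hy, G.stayProb_of_notMem hy]
    · simp [hx]

lemma inner_indVec_killedWalk (A : Finset V) :
    inner ℝ (indVec A) (G.killedWalk A (indVec A)) = G.weight A A := by
  rw [inner_killedWalk]
  simp [indVec_apply, weight]

variable {G} in
-- The spectral bound with `x` and `z` the indicators of `B` and `A`. Any `B` of at least half the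
-- size of `A` is allowed, so that `B` can be a set of bad starting vertices.
lemma IsLazy.pow_mul_card_le_sum_stayProb (hG : G.IsLazy) {A B : Finset V} (hB : B ⊆ A)
    (hne : B.Nonempty) (hcard : (A.card : ℝ) ≤ 2 * B.card) (hφ : 0 < G.expansion A)
    (hφ8 : 8 * G.expansion A ≤ 1) (t : ℕ) :
    (1 - 8 * G.expansion A) ^ t * ((B.card : ℝ) / 8) ≤ ∑ x ∈ B, G.stayProb A t x := by
  have hA0 : (0 : ℝ) < A.card := by exact_mod_cast (hne.mono hB).card_pos
  have h := (G.isSymmetric_killedWalk A).pow_mul_norm_sq_le_inner_pow (x := indVec B)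
    (z := indVec A) (fun u => ?_) (G.inner_killedWalk_le A) hφ hφ8 ?_ ?_ ?_ ?_ t
  · rw [norm_indVec_sq, inner_indVec] at h
    exact h.trans (Finset.sum_le_sum fun x _ => G.killedWalk_pow_indVec_le hB t x)
  · rw [inner_killedWalk]
    exact hG.sum_sum_w_mul_mul_nonneg _
  · intro h0
    have := norm_indVec_sq B
    rw [h0] at this
    simp only [norm_zero, ne_eq, OfNat.ofNat_ne_zero, not_false_eq_true, zero_pow] at this
    have h2 : (0 : ℝ) < B.card := by exact_mod_cast hne.card_pos
    linarith
  · rw [norm_indVec_sq, inner_indVec]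
    simp only [indVec_apply]
    rw [Finset.sum_congr rfl fun x hx => if_pos (hB hx)]
    simp
  · rwa [norm_indVec_sq, norm_indVec_sq]
  · rw [norm_indVec_sq, inner_indVec_killedWalk]
    have := G.weight_self_add_weight_compl A
    have h2 : G.expansion A * A.card = G.weight A Aᶜ := by
      unfold expansion
      field_simp
    linarith

variable {G} in
/-- For at least half of the starting vertices the walk is not much more likely to leave `A` than
on average. -/
lemma IsLazy.exists_subset_le_stayProb (hG : G.IsLazy) (A : Finset V) (hφ : 0 < G.expansion A)
    (hφ8 : 8 * G.expansion A ≤ 1) (t : ℕ) :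
    ∃ A' : Finset V, A' ⊆ A ∧ (A.card : ℝ) / 2 ≤ (A'.card : ℝ) ∧
      ∀ v ∈ A', (1 - 8 * G.expansion A) ^ t / 8 ≤ G.stayProb A t v := by
  set δ := (1 - 8 * G.expansion A) ^ t / 8 with hδ
  refine ⟨A.filter fun v => δ ≤ G.stayProb A t v, Finset.filter_subset _ _, ?_,
    fun v hv => (Finset.mem_filter.1 hv).2⟩
  by_contra! h
  set B := A.filter fun v => ¬ δ ≤ G.stayProb A t v with hBdef
  have hc : ((A.filter fun v => δ ≤ G.stayProb A t v).card : ℝ) + B.card = A.card := by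
    exact_mod_cast Finset.card_filter_add_card_filter_not (s := A) _
  have hB0 : 0 < (B.card : ℝ) := by
    have : (0 : ℝ) ≤ (A.filter fun v => δ ≤ G.stayProb A t v).card := Nat.cast_nonneg _
    linarith
  have hne : B.Nonempty := Finset.card_pos.1 (by exact_mod_cast hB0)
  have h1 := hG.pow_mul_card_le_sum_stayProb (Finset.filter_subset _ _) hne (by linarith) hφ hφ8 t
  have h2 : ∑ x ∈ B, G.stayProb A t x < ∑ x ∈ B, δ :=
    Finset.sum_lt_sum_of_nonempty hne fun x hx => not_le.1 (Finset.mem_filter.1 hx).2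
  rw [Finset.sum_const, nsmul_eq_mul, hδ] at h2
  nlinarith

variable {G} in
lemma IsLazy.exists_subset_rpow_le_stayProb (hG : G.IsLazy) {A : Finset V} (hA : A.Nonempty)
    (hφ : 0 < G.expansion A) {ε : ℝ} (hε : 0 < ε) :
    ∃ A' : Finset V, A' ⊆ A ∧ (A.card : ℝ) / 2 ≤ (A'.card : ℝ) ∧
      ∀ v ∈ A', Real.exp (-2) / 8 * (A.card : ℝ) ^ (-ε) ≤
        G.stayProb A ⌈1 / 16 * (1 + ε * Real.log A.card) / G.expansion A⌉₊ v := by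
  have hA1 : (1 : ℝ) ≤ A.card := by exact_mod_cast hA.card_pos
  have hlog := Real.log_nonneg hA1
  have hle : Real.exp (-2) / 8 * (A.card : ℝ) ^ (-ε) =
      Real.exp (-2 - ε * Real.log A.card) / 8 := by
    rw [Real.rpow_def_of_pos (by linarith), sub_eq_add_neg, Real.exp_add]
    ring_nf
  set φ := G.expansion A with hφdef
  have hφ2 : φ ≤ 1 / 2 := hG.expansion_le_half A
  set T := ⌈1 / 16 * (1 + ε * Real.log A.card) / φ⌉₊ with hT
  have hεl : 0 ≤ ε * Real.log A.card := by positivity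
  have hTle : (T : ℝ) ≤ 1 / 16 * (1 + ε * Real.log A.card) / φ + 1 :=
    (Nat.ceil_lt_add_one (by positivity)).le
  have hφT : φ * T ≤ 1 / 16 * (1 + ε * Real.log A.card) + φ := by
    calc φ * T ≤ φ * (1 / 16 * (1 + ε * Real.log A.card) / φ + 1) := by gcongr
      _ = _ := by field_simp
  rw [hle]
  rcases le_total φ (1 / 16) with h | h
  · obtain ⟨A', hA', hc, hv⟩ := hG.exists_subset_le_stayProb A hφ (by linarith) T
    refine ⟨A', hA', hc, fun v hvA => le_trans ?_ (hv v hvA)⟩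
    gcongr
    -- Follows from `(1 + 16φ)(1 - 8φ) ≥ 1`, which is where `φ ≤ 1 / 16` enters.
    have h1 : Real.exp (-(16 * φ)) ≤ 1 - 8 * φ := by
      rw [Real.exp_neg]
      refine inv_le_of_inv_le₀ (by linarith) ?_
      have h2 := Real.add_one_le_exp (16 * φ)
      refine le_trans ?_ h2
      rw [inv_le_iff_one_le_mul₀ (by linarith)]
      nlinarith
    calc Real.exp (-2 - ε * Real.log A.card) ≤ Real.exp (-(16 * φ)) ^ T := by
          rw [← Real.exp_nat_mul]
          apply Real.exp_le_exp.2
          linarith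
      _ ≤ _ := pow_le_pow_left₀ (Real.exp_pos _).le h1 T
  -- For large `φ` the time `T` is at most `2 + ε log k`, and standing still for `T` steps is
  -- already likely enough from every vertex.
  · refine ⟨A, subset_rfl, by linarith, fun v hv => le_trans ?_ (hG.pow_le_stayProb hv T)⟩
    have h1 : Real.exp (-1) ≤ 1 / 2 := by
      rw [Real.exp_neg, one_div]
      exact inv_anti₀ (by norm_num) (by linarith [Real.add_one_le_exp (1 : ℝ)])
    have h2 : (T : ℝ) ≤ 2 + ε * Real.log A.card := by
      have : 1 / 16 * (1 + ε * Real.log A.card) / φ ≤ 1 + ε * Real.log A.card := by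
        rw [div_le_iff₀ hφ]
        nlinarith
      linarith
    calc Real.exp (-2 - ε * Real.log A.card) / 8 ≤ Real.exp (-2 - ε * Real.log A.card) := by
          linarith [Real.exp_pos (-2 - ε * Real.log A.card)]
      _ ≤ Real.exp (-1) ^ T := by
          rw [← Real.exp_nat_mul]
          apply Real.exp_le_exp.2
          linarith
      _ ≤ _ := pow_le_pow_left₀ (Real.exp_pos _).le h1 T

end RegularGraph
end

/-! ### Failure probability and expected cost of the copies. -/

noncomputable section

namespace PMF

variable {α β : Type*}

/-- The mean of an extended nonnegative function under a probability mass function. -/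
def lmean (p : PMF α) (g : α → ℝ≥0∞) : ℝ≥0∞ := ∑' a, p a * g a

lemma lmean_bind (p : PMF α) (f : α → PMF β) (g : β → ℝ≥0∞) :
    (p.bind f).lmean g = p.lmean fun a => (f a).lmean g := by
  simp only [lmean, bind_apply, ← ENNReal.tsum_mul_right, ← ENNReal.tsum_mul_left]
  rw [ENNReal.tsum_comm]
  simp only [mul_assoc]

lemma lmean_pure (a : α) (g : α → ℝ≥0∞) : (PMF.pure a).lmean g = g a := by
  rw [lmean, tsum_eq_single a fun b hb => by simp [hb]]
  simp

lemma lmean_map (p : PMF α) (f : α → β) (g : β → ℝ≥0∞) :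
    (p.map f).lmean g = p.lmean (g ∘ f) := by
  rw [← bind_pure_comp, lmean_bind]
  simp [lmean_pure, Function.comp_def]

lemma lmean_const (p : PMF α) (c : ℝ≥0∞) : (p.lmean fun _ => c) = c := by
  rw [lmean, ENNReal.tsum_mul_right, p.tsum_coe, one_mul]

lemma lmean_add (p : PMF α) (g h : α → ℝ≥0∞) :
    (p.lmean fun a => g a + h a) = p.lmean g + p.lmean h := by
  simp only [lmean, mul_add, ENNReal.tsum_add]

lemma lmean_mono (p : PMF α) {g h : α → ℝ≥0∞} (hgh : ∀ a, g a ≤ h a) : p.lmean g ≤ p.lmean h :=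
  ENNReal.tsum_le_tsum fun a => mul_le_mul_right (hgh a) _

lemma mul_toOuterMeasure_le_lmean (p : PMF α) (g : α → ℝ≥0∞) (B : ℝ≥0∞) {s : Set α}
    (hs : ∀ a ∈ s, B ≤ g a) : B * p.toOuterMeasure s ≤ p.lmean g := by
  rw [toOuterMeasure_apply, lmean, ← ENNReal.tsum_mul_left]
  refine ENNReal.tsum_le_tsum fun a => ?_
  by_cases ha : a ∈ s
  · rw [Set.indicator_of_mem ha, mul_comm]
    exact mul_le_mul_right (hs a ha) _
  · simp [ha]

end PMF

namespace RegularGraph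

variable {V : Type*} [Fintype V] [DecidableEq V] (G : RegularGraph V)

/-- Reduces the inductions over `runCopy` to real sums. The empty set has biased probability `0`, so
bounds are needed on nonempty sets only. -/
lemma tsum_biasedStep_le {S : Finset V} (hS : S.Nonempty) {F : Finset V → ℝ≥0∞}
    {g : Finset V → ℝ} (hg : ∀ S' : Finset V, S'.Nonempty → 0 ≤ g S')
    (hF : ∀ S' : Finset V, S'.Nonempty → F S' ≤ ENNReal.ofReal (g S')) :
    ∑' S' : Finset V, G.biasedStep S S' * F S' ≤
      ENNReal.ofReal (∑ S' : Finset V, G.biasedProb S S' * g S') := by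
  rw [tsum_fintype, ENNReal.ofReal_sum_of_nonneg]
  · refine Finset.sum_le_sum fun S' _ => ?_
    rw [G.biasedStep_apply hS]
    rcases S'.eq_empty_or_nonempty with rfl | h
    · simp [biasedProb_empty]
    · rw [ENNReal.ofReal_mul (G.biasedProb_nonneg _ _)]
      exact mul_le_mul_right (hF S' h) _
  · intro S' _
    rcases S'.eq_empty_or_nonempty with rfl | h
    · simp [biasedProb_empty]
    · exact mul_nonneg (G.biasedProb_nonneg _ _) (hg S' h)

lemma nonempty_of_mem_support_biasedStep {S S' : Finset V} (hS : S.Nonempty)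
    (h : S' ∈ (G.biasedStep S).support) : S'.Nonempty := by
  rw [PMF.mem_support_iff, G.biasedStep_apply hS] at h
  by_contra h0
  rw [Finset.not_nonempty_iff_eq_empty] at h0
  simp [h0, biasedProb_empty] at h

lemma runCopy_mem_support {K θ : ℝ} {T : ℕ} {S S₁ : Finset V} {m : ℕ} (hS : S.Nonempty)
    (h : (some S₁, m) ∈ (G.runCopy K θ T S).support) :
    S₁.Nonempty ∧ (S₁.card : ℝ) ≤ K ∧ G.Psi S₁ ≤ θ := by
  induction T generalizing S m with
  | zero =>
    rw [runCopy] at h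
    split_ifs at h with hc
    · simp only [PMF.support_pure, Set.mem_singleton_iff, Prod.mk.injEq, Option.some.injEq] at h
      rw [h.1]
      exact ⟨hS, hc⟩
    · simp at h
  | succ T ih =>
    rw [runCopy] at h
    split_ifs at h with hc
    · simp only [PMF.support_pure, Set.mem_singleton_iff, Prod.mk.injEq, Option.some.injEq] at h
      rw [h.1]
      exact ⟨hS, hc⟩
    · simp only [PMF.support_bind, Set.mem_iUnion, exists_prop] at h
      obtain ⟨S', hS', h⟩ := h
      split_ifs at h with hK
      · simp only [PMF.support_map, Set.mem_image, Prod.mk.injEq] at h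
        obtain ⟨⟨o, j⟩, hr, ho, -⟩ := h
        simp only at ho
        subst ho
        exact ih (G.nonempty_of_mem_support_biasedStep hS hS') hr
      · simp at h

lemma runCopies_mem_support {K θ : ℝ} {T N : ℕ} {v : V} {S : Finset V} {m : ℕ}
    (h : (some S, m) ∈ (G.runCopies K θ T v N).support) :
    S.Nonempty ∧ (S.card : ℝ) ≤ K ∧ G.Psi S ≤ θ := by
  induction N generalizing m with
  | zero => simp [runCopies] at h
  | succ N ih =>
    rw [runCopies] at h
    simp only [PMF.support_bind, Set.mem_iUnion, exists_prop] at h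
    obtain ⟨⟨o, j⟩, hr, h⟩ := h
    rcases o with _ | S₁
    · simp only [PMF.support_map, Set.mem_image, Prod.mk.injEq] at h
      obtain ⟨⟨o, j⟩, hr, ho, -⟩ := h
      simp only at ho
      subst ho
      exact ih hr
    · simp only [PMF.support_pure, Set.mem_singleton_iff, Prod.mk.injEq, Option.some.injEq] at h
      rw [h.1]
      exact G.runCopy_mem_support (Finset.singleton_nonempty v) hr

/-- A run of one copy fails with probability at most the probability that a walk from a random
vertex of `S` leaves `A`, up to an error for too large sets and one for small `Ψ`. -/
lemma IsLazy.runCopy_none_le {G : RegularGraph V} (hG : G.IsLazy) (A : Finset V) {K θ : ℝ}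
    (hK : 0 < K) (T : ℕ) {S : Finset V} (hS : S.Nonempty) (hSK : (S.card : ℝ) ≤ K) :
    (G.runCopy K θ T S).toOuterMeasure {r | r.1 = none} ≤
      ENNReal.ofReal (1 - (∑ x ∈ S, G.stayProb A T x) / S.card + A.card / K +
        √(K / S.card) * Real.exp (-(θ * T / 24))) := by
  have havg : ∀ (t : ℕ) (S' : Finset V), (∑ x ∈ S', G.stayProb A t x) / S'.card ≤ 1 :=
    fun t S' => by
      refine div_le_one_of_le₀ ?_ (Nat.cast_nonneg _)
      calc _ ≤ ∑ x ∈ S', (1 : ℝ) := Finset.sum_le_sum fun x _ => G.stayProb_le_one A t x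
        _ = _ := by simp
  have hnn : ∀ (t : ℕ) (S' : Finset V), 0 ≤ 1 - (∑ x ∈ S', G.stayProb A t x) / S'.card +
      A.card / K + √(K / S'.card) * Real.exp (-(θ * t / 24)) := fun t S' => by
    have h1 := havg t S'
    have h2 : (0 : ℝ) ≤ A.card / K := by positivity
    have h3 : 0 ≤ √(K / S'.card) * Real.exp (-(θ * t / 24)) := by positivity
    linarith
  induction T generalizing S with
  | zero =>
    have hS0 : (0 : ℝ) < S.card := by exact_mod_cast hS.card_pos
    rw [runCopy]
    split_ifs with hc
    · simp
    · simp only [PMF.toOuterMeasure_pure_apply, Set.mem_ofPred_eq, if_true]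
      rw [← ENNReal.ofReal_one]
      refine ENNReal.ofReal_le_ofReal ?_
      have h1 := havg 0 S
      have h2 : (0 : ℝ) ≤ A.card / K := by positivity
      -- When time runs out the set still has size at most `K`, so the growth term alone makes the
      -- bound at least `1`.
      have h3 : 1 ≤ √(K / S.card) := Real.one_le_sqrt.2 ((one_le_div hS0).2 hSK)
      simp only [Nat.cast_zero, mul_zero, zero_div, neg_zero, Real.exp_zero, mul_one]
      linarith
  | succ T ih =>
    have hS0 : (0 : ℝ) < S.card := by exact_mod_cast hS.card_pos
    rw [runCopy]
    split_ifs with hc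
    · simp
    have hΨ : θ < G.Psi S := by
      by_contra! h
      exact hc ⟨hSK, h⟩
    rw [PMF.toOuterMeasure_bind_apply]
    refine (G.tsum_biasedStep_le hS (g := fun S' => 1 -
      (∑ x ∈ S', G.stayProb A T x) / S'.card + A.card / K +
        √(K / S'.card) * Real.exp (-(θ * T / 24))) (fun S' _ => hnn T S') fun S' hS' => ?_).trans
      (ENNReal.ofReal_le_ofReal ?_)
    · have hS'0 : (0 : ℝ) < S'.card := by exact_mod_cast hS'.card_pos
      split_ifs with hS'K
      · rw [PMF.toOuterMeasure_map_apply]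
        exact ih hS' hS'K
      · simp only [PMF.toOuterMeasure_pure_apply, Set.mem_ofPred_eq, if_true]
        rw [← ENNReal.ofReal_one]
        refine ENNReal.ofReal_le_ofReal ?_
        -- An oversized set has at most a fraction `|A| / K` of its vertices in `A`; so the bound is
        -- at least `1` when the copy is abandoned.
        have h1 : (∑ x ∈ S', G.stayProb A T x) / S'.card ≤ A.card / K :=
          div_le_div₀ (Nat.cast_nonneg _) (G.sum_stayProb_le A S' T) hK (not_le.1 hS'K).le
        have h3 : 0 ≤ √(K / S'.card) * Real.exp (-(θ * T / 24)) := by positivity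
        linarith
    · have e1 : ∀ S' : Finset V, G.biasedProb S S' * (1 -
          (∑ x ∈ S', G.stayProb A T x) / S'.card + A.card / K +
          √(K / S'.card) * Real.exp (-(θ * T / 24))) =
          G.biasedProb S S' * (1 + A.card / K) -
          G.biasedProb S S' * ((∑ x ∈ S', G.stayProb A T x) / S'.card) +
          G.biasedProb S S' * √((S.card : ℝ) / S'.card) *
            (√(K / S.card) * Real.exp (-(θ * T / 24))) := fun S' => by
        have : √(K / S'.card) = √((S.card : ℝ) / S'.card) * √(K / S.card) := by
          rw [← Real.sqrt_mul (by positivity)]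
          congr 1
          rw [div_mul_div_comm, mul_comm (S'.card : ℝ), mul_div_mul_left _ _ hS0.ne']
        rw [this]
        ring
      rw [Finset.sum_congr rfl fun S' _ => e1 S', Finset.sum_add_distrib,
        Finset.sum_sub_distrib, ← Finset.sum_mul, ← Finset.sum_mul, G.sum_biasedProb hS,
        sum_biasedProb_mul_average]
      have e2 : (∑ x ∈ S, G.stayProb A (T + 1) x) / S.card ≤
          (∑ x ∈ S, ∑ y, G.w x y * G.stayProb A T y) / S.card := by
        gcongr with x hx
        rw [stayProb]
        split_ifs
        · rfl
        · exact Finset.sum_nonneg fun y _ => mul_nonneg (G.nonneg x y) (G.stayProb_nonneg A T y)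
      -- The copy has not returned, so `Ψ(S) > θ` and the growth term contracts by `exp (-θ / 24)`.
      have e3 : ∑ S' : Finset V, G.biasedProb S S' * √((S.card : ℝ) / S'.card) ≤
          Real.exp (-(θ / 24)) := by
        refine (hG.sum_biasedProb_mul_sqrt_le hS).trans ?_
        have := Real.add_one_le_exp (-(θ / 24))
        linarith
      have e4 := mul_le_mul_of_nonneg_right e3
        (show 0 ≤ √(K / S.card) * Real.exp (-(θ * T / 24)) by positivity)
      have e5 : Real.exp (-(θ / 24)) * (√(K / S.card) * Real.exp (-(θ * T / 24))) =
          √(K / S.card) * Real.exp (-(θ * (T + 1 : ℕ) / 24)) := by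
        rw [mul_left_comm, ← Real.exp_add]
        congr 2
        push_cast
        ring
      linarith

lemma deg_le_maxDeg (x : V) : G.deg x ≤ G.maxDeg := Finset.le_sup (f := G.deg) (Finset.mem_univ x)

lemma IsLazy.one_le_maxDeg {G : RegularGraph V} (hG : G.IsLazy) (v : V) : 1 ≤ G.maxDeg := by
  refine le_trans (Finset.card_pos.2 ⟨v, ?_⟩) (G.deg_le_maxDeg v)
  simpa using lt_of_lt_of_le (by norm_num) (hG v)

lemma IsLazy.moveCost_le {G : RegularGraph V} (hG : G.IsLazy) (S S' : Finset V) :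
    (G.moveCost S S' : ℝ) ≤ 2 * G.opCost * G.maxDeg * (symmDiff S S').card := by
  unfold moveCost
  split_ifs with h
  · simp [h]
  have hne : (symmDiff S S').Nonempty := by
    rw [Finset.nonempty_iff_ne_empty, ← Finset.bot_eq_empty, Ne, symmDiff_eq_bot]
    exact fun h' => h h'.symm
  obtain ⟨v, hv⟩ := hne
  have h1 : 1 ≤ (symmDiff S S').card := Finset.card_pos.2 ⟨v, hv⟩
  have h2 := hG.one_le_maxDeg v
  have h3 : ∑ x ∈ symmDiff S S', G.deg x ≤ (symmDiff S S').card * G.maxDeg := by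
    rw [← smul_eq_mul]
    exact Finset.sum_le_card_nsmul _ _ _ fun x _ => G.deg_le_maxDeg x
  have h4 : 1 ≤ (symmDiff S S').card * G.maxDeg := Nat.mul_pos h1 h2
  have : G.opCost * (1 + ∑ x ∈ symmDiff S S', G.deg x) ≤
      2 * G.opCost * G.maxDeg * (symmDiff S S').card := by
    calc _ ≤ G.opCost * ((symmDiff S S').card * G.maxDeg + (symmDiff S S').card * G.maxDeg) := by
          gcongr
      _ = _ := by ring
  exact_mod_cast this

lemma log_card_le (S : Finset V) : Real.log S.card ≤ Real.log (Fintype.card V) := by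
  rcases S.eq_empty_or_nonempty with rfl | hS
  · simpa using Real.log_natCast_nonneg _
  · exact Real.log_le_log (by exact_mod_cast hS.card_pos) (by exact_mod_cast S.card_le_univ)

/-- The expected running time of one copy. -/
lemma IsLazy.runCopy_cost_le {G : RegularGraph V} (hG : G.IsLazy) {K θ α : ℝ} (hK : 0 ≤ K)
    (hα : 0 < α) (T : ℕ) {S : Finset V} (hS : S.Nonempty) :
    (G.runCopy K θ T S).lmean (fun r => (r.2 : ℝ≥0∞)) ≤
      ENNReal.ofReal (G.opCost + 2 * G.opCost * G.maxDeg * K *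
        (α * T + 12 / α * (Real.log (Fintype.card V) - Real.log S.card))) := by
  have hnn : ∀ (t : ℕ) (S' : Finset V), 0 ≤ 2 * G.opCost * G.maxDeg * K *
      (α * t + 12 / α * (Real.log (Fintype.card V) - Real.log S'.card)) := fun t S' => by
    have := sub_nonneg.2 (log_card_le S')
    positivity
  induction T generalizing S with
  | zero =>
    rw [runCopy]
    split_ifs <;> simp [PMF.lmean_pure]
  | succ T ih =>
    rw [runCopy]
    split_ifs with hc
    · simp [PMF.lmean_pure]
    rw [PMF.lmean_bind]
    refine (G.tsum_biasedStep_le hS (g := fun S' => G.opCost + 2 * G.opCost * G.maxDeg * K *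
      ((symmDiff S S').card / S'.card) + 2 * G.opCost * G.maxDeg * K *
        (α * T + 12 / α * (Real.log (Fintype.card V) - Real.log S'.card)))
      (fun S' _ => ?_) fun S' hS' => ?_).trans (ENNReal.ofReal_le_ofReal ?_)
    · have := hnn T S'
      positivity
    · have hS'0 : (0 : ℝ) < S'.card := by exact_mod_cast hS'.card_pos
      split_ifs with hS'K
      · rw [PMF.lmean_map]
        simp only [Function.comp_def, Nat.cast_add, PMF.lmean_add, PMF.lmean_const]
        refine (add_le_add_right (ih hS') _).trans ?_
        rw [← ENNReal.ofReal_natCast, ← ENNReal.ofReal_add (Nat.cast_nonneg _)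
          (add_nonneg (Nat.cast_nonneg _) (hnn T S'))]
        refine ENNReal.ofReal_le_ofReal ?_
        -- Since `|S'| ≤ K`, a factor `K / |S'| ≥ 1` can be inserted; its denominator cancels the
        -- size bias in the mean.
        have h1 : (G.moveCost S S' : ℝ) ≤
            2 * G.opCost * G.maxDeg * K * ((symmDiff S S').card / S'.card) := by
          refine (hG.moveCost_le S S').trans ?_
          rw [mul_assoc _ K, mul_div_assoc', mul_comm K, mul_div_assoc]
          refine mul_le_mul_of_nonneg_left ?_ (by positivity)
          exact le_mul_of_one_le_right (Nat.cast_nonneg _) ((one_le_div hS'0).2 hS'K)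
        linarith
      · rw [PMF.lmean_pure, ← ENNReal.ofReal_natCast]
        refine ENNReal.ofReal_le_ofReal ?_
        have h1 : 0 ≤ 2 * G.opCost * G.maxDeg * K * ((symmDiff S S').card / S'.card : ℝ) := by
          positivity
        have := hnn T S'
        linarith
    · have e1 : ∀ S' : Finset V, G.biasedProb S S' * (G.opCost + 2 * G.opCost * G.maxDeg * K *
          ((symmDiff S S').card / S'.card) + 2 * G.opCost * G.maxDeg * K *
          (α * T + 12 / α * (Real.log (Fintype.card V) - Real.log S'.card))) =
          G.biasedProb S S' * (G.opCost + 2 * G.opCost * G.maxDeg * K *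
            (α * T + 12 / α * Real.log (Fintype.card V))) +
          2 * G.opCost * G.maxDeg * K *
            (G.biasedProb S S' * ((symmDiff S S').card / S'.card)) -
          2 * G.opCost * G.maxDeg * K * (12 / α) *
            (G.biasedProb S S' * Real.log S'.card) := fun S' => by ring
      rw [Finset.sum_congr rfl fun S' _ => e1 S', Finset.sum_sub_distrib, Finset.sum_add_distrib,
        ← Finset.sum_mul, ← Finset.mul_sum, ← Finset.mul_sum, G.sum_biasedProb hS]
      set M : ℝ := 2 * G.opCost * G.maxDeg * K with hM
      have hM0 : 0 ≤ M := by positivity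
      have e2 := mul_le_mul_of_nonneg_left (G.sum_biasedProb_mul_symmDiff S) hM0
      have e3 := mul_le_mul_of_nonneg_left (hG.le_sum_biasedProb_mul_log hS)
        (show 0 ≤ M * (12 / α) by positivity)
      -- AM-GM splits the mean change into `α`, paid by the step count, and a multiple of the drift
      -- of `log |S|`, paid by the decrease of `log n - log |S|`.
      have e4 : 2 * G.expansion S ≤ α + 12 / α * (G.expansion S ^ 2 / 12) := by
        have : 12 / α * (G.expansion S ^ 2 / 12) = G.expansion S ^ 2 / α := by ring
        rw [this, ← sub_nonneg]
        have : α + G.expansion S ^ 2 / α - 2 * G.expansion S =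
            (α - G.expansion S) ^ 2 / α := by
          field_simp
          ring
        rw [this]
        positivity
      have e5 := mul_le_mul_of_nonneg_left e4 hM0
      push_cast
      linarith

lemma runCopies_none_eq (K θ : ℝ) (T : ℕ) (v : V) (N : ℕ) :
    (G.runCopies K θ T v N).toOuterMeasure {r | r.1 = none} =
      (G.runCopy K θ T {v}).toOuterMeasure {r | r.1 = none} ^ N := by
  induction N with
  | zero => simp [runCopies]
  | succ N ih =>
    rw [runCopies, PMF.toOuterMeasure_bind_apply, pow_succ', ← ih, PMF.toOuterMeasure_apply,
      ← ENNReal.tsum_mul_right]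
    refine tsum_congr ?_
    rintro ⟨_ | S, t⟩
    · simp only [PMF.toOuterMeasure_map_apply, Set.mem_ofPred_eq, Set.indicator_of_mem]
      rfl
    · simp

/-- Stopping early only saves time, so all `N` copies are charged. -/
lemma runCopies_cost_le (K θ : ℝ) (T : ℕ) (v : V) (N : ℕ) :
    (G.runCopies K θ T v N).lmean (fun r => (r.2 : ℝ≥0∞)) ≤
      N * ((G.opCost * (1 + G.deg v) : ℕ) +
        (G.runCopy K θ T {v}).lmean (fun r => (r.2 : ℝ≥0∞))) := by
  induction N with
  | zero => simp [runCopies, PMF.lmean_pure]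
  | succ N ih =>
    set m := G.opCost * (1 + G.deg v) with hm
    have h : (G.runCopies K θ T v (N + 1)).lmean (fun r => (r.2 : ℝ≥0∞)) ≤
        (G.runCopy K θ T {v}).lmean (fun r => (m : ℝ≥0∞) + r.2 +
          (G.runCopies K θ T v N).lmean (fun r => (r.2 : ℝ≥0∞))) := by
      rw [runCopies, PMF.lmean_bind]
      refine PMF.lmean_mono _ ?_
      rintro ⟨_ | S, t⟩
      · simp only [PMF.lmean_map, Function.comp_def, Nat.cast_add, PMF.lmean_add,
          PMF.lmean_const]
        rfl
      · simp only [PMF.lmean_pure, Nat.cast_add]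
        exact le_self_add
    simp only [PMF.lmean_add, PMF.lmean_const] at h
    refine (h.trans (add_le_add_right ih _)).trans_eq ?_
    push_cast
    ring

end RegularGraph
end

/-! ### Choice of the constants and the final estimate. -/

noncomputable section

namespace RegularGraph

variable {V : Type*} [Fintype V] [DecidableEq V] (G : RegularGraph V)

/-- The bound by `4 / p₀` controls the error `|A| / K`. The last two conditions control the growth
error: one its power of `k`, the other its constant factor. Here `384 = 16 · 24`, from the `1 / 16`
in the number of steps and the growth rate `Ψ / 24`. -/
lemma exists_algorithm_constant {ε₀ p₀ : ℝ} (hε₀ : 0 < ε₀) (hp₀ : 0 < p₀) :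
    ∃ C : ℝ, 1 ≤ C ∧ 4 / p₀ ≤ C ∧ (1 + ε₀) / 2 + ε₀ ≤ C / 384 ∧
      √C * Real.exp (-(C / (384 * ε₀))) ≤ p₀ / 4 := by
  have h : Filter.Tendsto (fun C : ℝ => C * Real.exp (-(1 / (384 * ε₀) * C)))
      Filter.atTop (nhds 0) := by
    simpa using tendsto_rpow_mul_exp_neg_mul_atTop_nhds_zero 1 (1 / (384 * ε₀)) (by positivity)
  obtain ⟨C, h1, h2, h3, h4⟩ := ((Filter.eventually_ge_atTop 1).and
    ((Filter.eventually_ge_atTop (4 / p₀)).and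
      ((Filter.eventually_ge_atTop (384 * ((1 + ε₀) / 2 + ε₀))).and
        (h.eventually_le_const (show 0 < p₀ / 4 by positivity))))).exists
  refine ⟨C, h1, h2, by linarith, le_trans ?_ h4⟩
  have e : -(C / (384 * ε₀)) = -(1 / (384 * ε₀) * C) := by ring
  rw [e]
  refine mul_le_mul_of_nonneg_right ?_ (Real.exp_pos _).le
  exact Real.sqrt_le_iff.2 ⟨by linarith, by nlinarith⟩

/-- A single copy fails with probability at most `1 - Ω(k ^ (-ε))`. -/
lemma IsLazy.runCopy_singleton_none_le {G : RegularGraph V} (hG : G.IsLazy) {ε₀ p₀ C ε : ℝ}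
    (hp₀ : 0 < p₀) (hC1 : 1 ≤ C) (hCp : 4 / p₀ ≤ C) (hC2 : (1 + ε₀) / 2 + ε₀ ≤ C / 384)
    (hC3 : √C * Real.exp (-(C / (384 * ε₀))) ≤ p₀ / 4) {A : Finset V} (hA : A.Nonempty)
    (hφ : 0 < G.expansion A) (hε : 0 < ε) (hεε₀ : ε ≤ ε₀) {T : ℕ}
    (hT : 1 / 16 * (1 + ε * Real.log A.card) / G.expansion A ≤ T) {v : V}
    (hv : p₀ * (A.card : ℝ) ^ (-ε) ≤ G.stayProb A T v) :
    (G.runCopy (C * (A.card : ℝ) ^ (1 + ε)) (C * G.expansion A / ε) T {v}).toOuterMeasure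
      {r | r.1 = none} ≤ ENNReal.ofReal (1 - p₀ / 2 * (A.card : ℝ) ^ (-ε)) := by
  have hk1 : (1 : ℝ) ≤ A.card := by exact_mod_cast hA.card_pos
  set k := (A.card : ℝ) with hk
  set φ := G.expansion A with hφdef
  have hk0 : 0 < k := by linarith
  have hlog := Real.log_nonneg hk1
  have hK1 : 1 ≤ C * k ^ (1 + ε) :=
    one_le_mul_of_one_le_of_one_le hC1 (Real.one_le_rpow hk1 (by linarith))
  have hC0 : 0 < C := by linarith
  refine (hG.runCopy_none_le A (by linarith) T (Finset.singleton_nonempty v)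
    (by simpa using hK1)).trans (ENNReal.ofReal_le_ofReal ?_)
  simp only [Finset.sum_singleton, Finset.card_singleton, Nat.cast_one, div_one]
  have h1 : k / (C * k ^ (1 + ε)) ≤ p₀ / 4 * k ^ (-ε) := by
    have e : k / (C * k ^ (1 + ε)) = 1 / C * k ^ (-ε) := by
      rw [Real.rpow_add hk0, Real.rpow_one, Real.rpow_neg hk0.le]
      field_simp
    rw [e]
    refine mul_le_mul_of_nonneg_right ?_ (by positivity)
    rw [div_le_iff₀ hC0]
    rw [div_le_iff₀ hp₀] at hCp
    linarith
  have h2 : C / 384 * (1 / ε + Real.log k) ≤ C * φ / ε * T / 24 := by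
    calc C / 384 * (1 / ε + Real.log k) =
          C * φ / ε * (1 / 16 * (1 + ε * Real.log k) / φ) / 24 := by
          field_simp
          ring
      _ ≤ _ := by gcongr
  have h3 : √(C * k ^ (1 + ε)) = √C * Real.exp (Real.log k * ((1 + ε) / 2)) := by
    rw [Real.sqrt_mul hC0.le, Real.sqrt_eq_rpow (k ^ (1 + ε)), ← Real.rpow_mul hk0.le,
      Real.rpow_def_of_pos hk0]
    congr 3
    ring
  have h4 : √(C * k ^ (1 + ε)) * Real.exp (-(C * φ / ε * T / 24)) ≤ p₀ / 4 * k ^ (-ε) := by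
    calc √(C * k ^ (1 + ε)) * Real.exp (-(C * φ / ε * T / 24))
        ≤ √C * Real.exp (Real.log k * ((1 + ε) / 2)) *
          Real.exp (-(C / 384 * (1 / ε + Real.log k))) := by
          rw [h3]
          gcongr
      _ = √C * Real.exp (-(C / (384 * ε))) *
          Real.exp (Real.log k * ((1 + ε) / 2 - C / 384)) := by
          rw [mul_assoc, mul_assoc, ← Real.exp_add, ← Real.exp_add]
          congr 2
          field_simp
          ring
      _ ≤ √C * Real.exp (-(C / (384 * ε₀))) * Real.exp (Real.log k * (-ε)) := by
          gcongr
          linarith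
      _ ≤ p₀ / 4 * k ^ (-ε) := by
          rw [Real.rpow_def_of_pos hk0]
          exact mul_le_mul_of_nonneg_right hC3 (Real.exp_pos _).le
  linarith

lemma opCost_le (hn : 2 ≤ Fintype.card V) :
    (G.opCost : ℝ) ≤ 4 * Real.log (Fintype.card V) := by
  have hn' : (2 : ℝ) ≤ Fintype.card V := by exact_mod_cast hn
  have h2 := Real.log_two_gt_d9
  have hL : Real.log 2 ≤ Real.log (Fintype.card V) := Real.log_le_log two_pos hn'
  have hpow : ((2 : ℝ) ^ Nat.log 2 (Fintype.card V)) ≤ Fintype.card V := by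
    exact_mod_cast Nat.pow_log_le_self 2 (by omega)
  have h := Real.log_le_log (by positivity) hpow
  rw [Real.log_pow] at h
  have h0 : (0 : ℝ) ≤ Nat.log 2 (Fintype.card V) := Nat.cast_nonneg _
  unfold opCost
  push_cast
  nlinarith

/-- The expected running time of the algorithm. -/
lemma IsLazy.runCopies_cost_le_of_expansion {G : RegularGraph V} (hG : G.IsLazy) {ε₀ C ε : ℝ}
    (hC1 : 1 ≤ C) {A : Finset V} (hA : A.Nonempty) (hφ : 0 < G.expansion A) (hε : 0 < ε)
    (hεε₀ : ε ≤ ε₀) (θ : ℝ) (v : V) :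
    (G.runCopies (C * (A.card : ℝ) ^ (1 + ε)) θ
      ⌈1 / 16 * (1 + ε * Real.log A.card) / G.expansion A⌉₊ v
      ⌈C * (A.card : ℝ) ^ ε⌉₊).lmean (fun r => (r.2 : ℝ≥0∞)) ≤
      ENNReal.ofReal (2 * C * C * (4 * (36 + 2 * ε₀)) * (G.maxDeg * (A.card : ℝ) ^ (1 + 2 * ε) *
        (G.expansion A) ^ (-(1 / 2) : ℝ) * Real.log (Fintype.card V) ^ 2)) := by
  have hk1 : (1 : ℝ) ≤ A.card := by exact_mod_cast hA.card_pos
  have hlogk : Real.log A.card ≤ Real.log (Fintype.card V) := log_card_le A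
  have hφ2 : G.expansion A ≤ 1 / 2 := hG.expansion_le_half A
  -- On a single vertex the only nonempty set has no boundary.
  have hn : 2 ≤ Fintype.card V := by
    by_contra! h
    have hle := A.card_le_univ
    have hpos := hA.card_pos
    have : A = Finset.univ := Finset.eq_univ_of_card A (by omega)
    rw [this] at hφ
    simp [expansion, weight] at hφ
  have hop := G.opCost_le hn
  have hL : 1 / 2 ≤ Real.log (Fintype.card V) := by
    have h2 := Real.log_two_gt_d9
    have := Real.log_le_log two_pos (show (2 : ℝ) ≤ Fintype.card V by exact_mod_cast hn)
    linarith
  set L := Real.log (Fintype.card V) with hLdef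
  set k := (A.card : ℝ) with hk
  set φ := G.expansion A with hφdef
  set T := ⌈1 / 16 * (1 + ε * Real.log k) / φ⌉₊ with hT
  set K := C * k ^ (1 + ε) with hK
  set Δ := (G.maxDeg : ℝ) with hΔ
  set O := (G.opCost : ℝ) with hO
  have hO0 : 0 ≤ O := Nat.cast_nonneg _
  have hk0 : 0 < k := by linarith
  have hlog := Real.log_nonneg hk1
  have hΔ1 : 1 ≤ Δ := Nat.one_le_cast.2 (hG.one_le_maxDeg v)
  have hK1 : 1 ≤ K :=
    one_le_mul_of_one_le_of_one_le hC1 (Real.one_le_rpow hk1 (by linarith))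
  have hT0 : (T : ℝ) ≤ 1 / 16 * (1 + ε * Real.log k) / φ + 1 :=
    (Nat.ceil_lt_add_one (by positivity)).le
  have hs0 : 0 < √φ := Real.sqrt_pos.2 hφ
  have hs1 : √φ ≤ 1 := Real.sqrt_le_one.2 (by linarith)
  have hss : √φ * √φ = φ := Real.mul_self_sqrt hφ.le
  -- The choice `α = √φ` balances `α T`, with `T` of order at most `log n / φ`, against `12 log n /
  -- α`.
  have hcopy := hG.runCopy_cost_le (K := K) (θ := θ) (by linarith : 0 ≤ K) hs0 T
    (Finset.singleton_nonempty v)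
  simp only [Finset.card_singleton, Nat.cast_one, Real.log_one, sub_zero] at hcopy
  have hN : (⌈C * k ^ ε⌉₊ : ℝ) ≤ 2 * (C * k ^ ε) := by
    have h1 : 1 ≤ C * k ^ ε :=
      one_le_mul_of_one_le_of_one_le hC1 (Real.one_le_rpow hk1 hε.le)
    have := (Nat.ceil_lt_add_one (show 0 ≤ C * k ^ ε by linarith)).le
    linarith
  have hαT : √φ * T + 12 / √φ * L ≤ (15 + ε₀) * L / √φ := by
    rw [le_div_iff₀ hs0]
    have e : (√φ * T + 12 / √φ * L) * √φ = φ * T + 12 * L := by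
      rw [add_mul, mul_right_comm, hss]
      field_simp
    rw [e]
    have e2 : φ * T ≤ 1 / 16 * (1 + ε * Real.log k) + φ := by
      calc φ * T ≤ φ * (1 / 16 * (1 + ε * Real.log k) / φ + 1) := by gcongr
        _ = _ := by field_simp
    have e3 : ε * Real.log k ≤ ε₀ * L := mul_le_mul hεε₀ hlogk hlog (by linarith)
    nlinarith
  have hdeg : (G.deg v : ℝ) ≤ Δ := Nat.cast_le.2 (G.deg_le_maxDeg v)
  have hcost : O * (1 + G.deg v) + (O + 2 * O * Δ * K * (√φ * T + 12 / √φ * L)) ≤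
      4 * (36 + 2 * ε₀) * (Δ * K * (L ^ 2 / √φ)) := by
    have hε₀ : 0 < ε₀ := by linarith
    have h1 : 1 ≤ 2 * (L / √φ) := by
      rw [mul_div_assoc', le_div_iff₀ hs0]
      linarith
    have h2 : 3 * (O * Δ) ≤ 6 * (O * Δ * K * (L / √φ)) := by
      have : 1 ≤ K * (2 * (L / √φ)) := one_le_mul_of_one_le_of_one_le hK1 h1
      have h3 : 0 ≤ O * Δ := by positivity
      nlinarith
    have h3 : O * (1 + G.deg v) + O ≤ 3 * (O * Δ) := by nlinarith
    have h4 : 2 * O * Δ * K * (√φ * T + 12 / √φ * L) ≤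
        2 * O * Δ * K * ((15 + ε₀) * L / √φ) :=
      mul_le_mul_of_nonneg_left hαT (by positivity)
    calc _ ≤ (36 + 2 * ε₀) * (O * Δ * K * (L / √φ)) := by
          have : 2 * O * Δ * K * ((15 + ε₀) * L / √φ) =
            (30 + 2 * ε₀) * (O * Δ * K * (L / √φ)) := by ring
          linarith
      _ ≤ (36 + 2 * ε₀) * (4 * L * Δ * K * (L / √φ)) := by gcongr
      _ = _ := by ring
  refine (G.runCopies_cost_le K θ T v _).trans ?_
  have hnn : 0 ≤ O + 2 * O * Δ * K * (√φ * T + 12 / √φ * L) := by positivity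
  calc (⌈C * k ^ ε⌉₊ : ℝ≥0∞) * ((G.opCost * (1 + G.deg v) : ℕ) +
        (G.runCopy K θ T {v}).lmean (fun r => (r.2 : ℝ≥0∞)))
      ≤ (⌈C * k ^ ε⌉₊ : ℝ≥0∞) * ((G.opCost * (1 + G.deg v) : ℕ) +
        ENNReal.ofReal (O + 2 * O * Δ * K * (√φ * T + 12 / √φ * L))) := by gcongr
    _ = ENNReal.ofReal (⌈C * k ^ ε⌉₊ * (O * (1 + G.deg v) +
        (O + 2 * O * Δ * K * (√φ * T + 12 / √φ * L)))) := by
        rw [ENNReal.ofReal_mul (Nat.cast_nonneg _), ENNReal.ofReal_add (by positivity) hnn,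
          ENNReal.ofReal_natCast]
        congr 2
        rw [← ENNReal.ofReal_natCast]
        push_cast
        rfl
    _ ≤ _ := by
        refine ENNReal.ofReal_le_ofReal ?_
        calc _ ≤ 2 * (C * k ^ ε) * (4 * (36 + 2 * ε₀) * (Δ * K * (L ^ 2 / √φ))) :=
              mul_le_mul hN hcost (by positivity) (by positivity)
          _ = _ := by
              have e1 : φ ^ (-(1 / 2) : ℝ) = (√φ)⁻¹ := by
                rw [Real.rpow_neg hφ.le, Real.sqrt_eq_rpow]
              have e2 : k ^ (1 + 2 * ε) = k ^ ε * k ^ (1 + ε) := by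
                rw [← Real.rpow_add hk0]
                congr 1
                ring
              rw [e1, e2, hK]
              ring

end RegularGraph

end
theorem corollary1p5 (ε₀ : ℝ) (hε₀ : 0 < ε₀) :
    ∃ c C D p : ℝ, 0 < c ∧ 0 < C ∧ 0 < D ∧ 0 < p ∧
      ∀ (V : Type*) [Fintype V] [DecidableEq V] (G : RegularGraph V), G.IsLazy →
      ∀ A : Finset V, A.Nonempty → 0 < G.expansion A →
      ∀ ε : ℝ, 0 < ε → ε ≤ ε₀ →
      ∃ A' : Finset V, A' ⊆ A ∧ (A.card : ℝ) / 2 ≤ (A'.card : ℝ) ∧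
        ∀ v ∈ A',
          ENNReal.ofReal p ≤
            (G.evolvingSetAlgorithm c C v A.card (G.expansion A) ε).toOuterMeasure
              {r | ∃ S : Finset V, r.1 = some S ∧ S.Nonempty ∧
                G.Psi S ≤ C * G.expansion A / ε ∧
                (S.card : ℝ) ≤ C * (A.card : ℝ) ^ (1 + ε) ∧
                (r.2 : ℝ) ≤ D * (G.maxDeg : ℝ) * (A.card : ℝ) ^ (1 + 2 * ε) *
                  (G.expansion A) ^ (-(1 / 2) : ℝ) *
                  Real.log (Fintype.card V) ^ 2} := by
  have hp₀ : 0 < Real.exp (-2) / 8 := by positivity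
  obtain ⟨C, hC1, hCp, hC2, hC3⟩ := RegularGraph.exists_algorithm_constant hε₀ hp₀
  set p₀ := Real.exp (-2) / 8 with hp₀def
  set D₀ := 2 * C * C * (4 * (36 + 2 * ε₀)) with hD₀
  have hC0 : 0 < C := by linarith
  have hD₀pos : 0 < D₀ := by positivity
  -- All copies fail with probability at most `1 / 2`; the time exceeds four times the bound on its
  -- mean with probability at most `1 / 4`. This leaves `1 / 4`.
  refine ⟨1 / 16, C, 4 * D₀, 1 / 4, by norm_num, hC0, by positivity, by norm_num, ?_⟩
  intro V _ _ G hG A hA hφ ε hε hεε₀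
  obtain ⟨A', hA', hcard, hstay⟩ := hG.exists_subset_rpow_le_stayProb hA hφ hε
  refine ⟨A', hA', hcard, fun v hv => ?_⟩
  have hk1 : (1 : ℝ) ≤ A.card := by exact_mod_cast hA.card_pos
  have hk0 : (0 : ℝ) < A.card := by linarith
  have hcost := hG.runCopies_cost_le_of_expansion hC1 hA hφ hε hεε₀ (C * G.expansion A / ε) v
  have hfail := hG.runCopy_singleton_none_le hp₀ hC1 hCp hC2 hC3 hA hφ hε hεε₀
    (Nat.le_ceil _) (hstay v hv)
  unfold RegularGraph.evolvingSetAlgorithm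
  set P := G.runCopies (C * (A.card : ℝ) ^ (1 + ε)) (C * G.expansion A / ε)
    ⌈1 / 16 * (1 + ε * Real.log A.card) / G.expansion A⌉₊ v ⌈C * (A.card : ℝ) ^ ε⌉₊ with hP
  set X := G.maxDeg * (A.card : ℝ) ^ (1 + 2 * ε) * (G.expansion A) ^ (-(1 / 2) : ℝ) *
    Real.log (Fintype.card V) ^ 2 with hX
  have hnone : P.toOuterMeasure {r | r.1 = none} ≤ ENNReal.ofReal (1 / 2) := by
    rw [hP, RegularGraph.runCopies_none_eq]
    refine (pow_le_pow_left' hfail _).trans ?_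
    set ρ := p₀ / 2 * (A.card : ℝ) ^ (-ε) with hρ
    have h1 : 1 - ρ ≤ Real.exp (-ρ) := by linarith [Real.add_one_le_exp (-ρ)]
    refine (pow_le_pow_left' (ENNReal.ofReal_le_ofReal h1) _).trans ?_
    rw [← ENNReal.ofReal_pow (Real.exp_pos _).le, ← Real.exp_nat_mul]
    refine ENNReal.ofReal_le_ofReal ?_
    -- The factors `k ^ ε` and `k ^ (-ε)` cancel, and `C ≥ 4 / p₀`.
    have h2 : 1 ≤ ⌈C * (A.card : ℝ) ^ ε⌉₊ * ρ := by
      have hρ0 : 0 ≤ ρ := by positivity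
      calc 1 ≤ C * (p₀ / 2) := by
            rw [div_le_iff₀ hp₀] at hCp
            linarith
        _ = C * (A.card : ℝ) ^ ε * ρ := by
            rw [hρ, Real.rpow_neg hk0.le]
            field_simp
        _ ≤ _ := mul_le_mul_of_nonneg_right (Nat.le_ceil _) hρ0
    have h3 : Real.exp (-1) ≤ 1 / 2 := by
      rw [Real.exp_neg, one_div]
      exact inv_anti₀ (by norm_num) (by linarith [Real.add_one_le_exp (1 : ℝ)])
    refine (Real.exp_le_exp.2 ?_).trans h3
    linarith
  have hXpos : 0 < X := by
    have h1 : (0 : ℝ) < G.maxDeg := by exact_mod_cast hG.one_le_maxDeg v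
    have h2 : 1 < Fintype.card V := by
      by_contra! h
      have hpos := hA.card_pos
      have hle := A.card_le_univ
      have : A = Finset.univ := Finset.eq_univ_of_card A (by omega)
      rw [this] at hφ
      simp [RegularGraph.expansion, RegularGraph.weight] at hφ
    have h3 : 0 < Real.log (Fintype.card V) := Real.log_pos (by exact_mod_cast h2)
    positivity
  have hslow : P.toOuterMeasure {r | 4 * D₀ * X < (r.2 : ℝ)} ≤ ENNReal.ofReal (1 / 4) := by
    have h1 := (P.mul_toOuterMeasure_le_lmean (fun r => (r.2 : ℝ≥0∞))
      (ENNReal.ofReal (4 * D₀ * X)) (s := {r | 4 * D₀ * X < (r.2 : ℝ)}) fun r hr => by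
        rw [← ENNReal.ofReal_natCast]
        exact ENNReal.ofReal_le_ofReal (le_of_lt hr)).trans hcost
    have h2 : ENNReal.ofReal (D₀ * X) =
        ENNReal.ofReal (4 * D₀ * X) * ENNReal.ofReal (1 / 4) := by
      rw [← ENNReal.ofReal_mul (by positivity)]
      congr 1
      ring
    rw [h2] at h1
    exact (ENNReal.mul_le_mul_iff_right (by simp; positivity) ENNReal.ofReal_ne_top).1 h1
  set E := {r : Option (Finset V) × ℕ | ∃ S : Finset V, r.1 = some S ∧ S.Nonempty ∧
    G.Psi S ≤ C * G.expansion A / ε ∧ (S.card : ℝ) ≤ C * (A.card : ℝ) ^ (1 + ε) ∧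
    (r.2 : ℝ) ≤ 4 * D₀ * (G.maxDeg : ℝ) * (A.card : ℝ) ^ (1 + 2 * ε) *
      (G.expansion A) ^ (-(1 / 2) : ℝ) * Real.log (Fintype.card V) ^ 2} with hE
  have hone : 1 ≤ P.toOuterMeasure E + (ENNReal.ofReal (1 / 2) + ENNReal.ofReal (1 / 4)) := by
    calc 1 = P.toOuterMeasure (E ∪ ({r | r.1 = none} ∪ {r | 4 * D₀ * X < (r.2 : ℝ)})) := by
          symm
          rw [PMF.toOuterMeasure_apply_eq_one_iff]
          rintro ⟨_ | S, m⟩ hr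
          · exact Or.inr (Or.inl rfl)
          · rcases le_or_gt (m : ℝ) (4 * D₀ * X) with hm | hm
            · obtain ⟨h1, h2, h3⟩ := G.runCopies_mem_support hr
              refine Or.inl ⟨S, rfl, h1, h3, h2, hm.trans_eq ?_⟩
              rw [hX]
              ring
            · exact Or.inr (Or.inr hm)
      _ ≤ _ := (measure_union_le _ _).trans
          (add_le_add le_rfl ((measure_union_le _ _).trans (add_le_add hnone hslow)))
  rw [← ENNReal.ofReal_add (by norm_num) (by norm_num)] at hone
  have h1 : (1 : ℝ≥0∞) = ENNReal.ofReal (1 / 4) + ENNReal.ofReal (1 / 2 + 1 / 4) := by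
    rw [← ENNReal.ofReal_add (by norm_num) (by norm_num), ← ENNReal.ofReal_one]
    norm_num
  rw [h1] at hone
  exact (ENNReal.add_le_add_iff_right ENNReal.ofReal_ne_top).1 hone
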